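/- **Theorem 4.2 (modified field reproduces exact flow).** Let $\mathcal T$ be the set of (unordered) rooted trees $\tau=[\tau_1,\dots,\tau_m]$ (with $m\ge 0$; $m=0$ is the one-vertex tree), $\emptyset$ the empty tree, and put $|\tau|=1+\sum_i|\tau_i|$, $\gamma(\tau)=|\tau|\prod_i\gamma(\tau_i)$, $\sigma(\tau)=\prod_i\sigma(\tau_i)\cdot\mu_1!\mu_2!\cdots$, where $\mu_1,\mu_2,\dots$ count equal trees among $\tau_1,\dots,\tau_m$. For a smooth vector field $G$ on $\mathbb R^n$, which may be a formal power series $G=\sum_{k\ge0}h^kG_k$ in $h$ with smooth coefficients $G_k$, let $F_G([\tau_1,\dots,\tau_m])(z)=G^{(m)}(z)\big(F_G(\tau_1)(z),\dots,F_G(\tau_m)(z)\big)$ (expanded in powers of $h$), and for $a:\mathcal T\cup\{\emptyset\}\to\mathbb R$ let $$B_G(a,z)=a(\emptyset)z+\sum_{\tau\in\mathcal T}\frac{h^{|\tau|}}{\sigma(\tau)}a(\tau)F_G(\tau)(z),$$ a formal power series in $h$. A partition $p$ of $\tau$ is a choice of a set of edges of $\tau$ (fixing an ordering of the branches of $\tau$),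 called dashed; $P(p)$ is the list of the subtrees of $\tau$ that remain after removing the dashed edges, and the skeleton $\chi(p)\in\mathcal T$ is obtained by contracting each of these subtrees to a vertex and keeping the dashed edges as edges. For $a,b:\mathcal T\cup\{\emptyset\}\to\mathbb R$ let $b\star a(\emptyset)=a(\emptyset)$ and $b\star a(\tau)=\sum_{p}a(\chi(p))\prod_{\delta\in P(p)}b(\delta)$, the sum being over all partitions $p$ of $\tau$. Let $\Phi_h$ be a one-step method that has a B-series with coefficients $a$, that is, $\Phi_h^G(z)=B_G(a,z)$ for every such formal vector field $G$, and let $a(\emptyset)=1$. Let $b:\mathcal T\cup\{\emptyset\}\to\mathbb R$ satisfy $b(\emptyset)=0$ and $$b\star a(\tau)=\frac1{\gamma(\tau)}\qquad\text{for all }\tau\in\mathcal T .$$ Let $f:\mathbb R^n\to\mathbb R^n$ be a smooth ($C^\infty$) vector field and let $g$ be the formal ($h$-dependent) vector field defined by $hg(y)=B_f(b,y)$. Then for all $t_0\in\mathbb R$ and $z_0\in\mathbb R^n$ $$\Phi_h^g(z_0)=\varphi_h^f(z_0)$$ as formal power series in $h$, where $\varphi_h^f(z_0)=z(t_0+h)$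 is the exact solution of $\dot z=f(z)$, $z(t_0)=z_0$. That is, this initial value problem has a solution near $t_0$, every solution near $t_0$ is smooth at $t_0$, and for every $k\ge 0$ the coefficient of $h^k$ in $\Phi_h^g(z_0)=B_g(a,z_0)$ is $\frac1{k!}z^{(k)}(t_0)$. -/

import Mathlib

open scoped ContDiff Topology

/-- Ordered rooted trees: `node m c` is the tree `(c 0, …, c (m-1))` obtained by grafting the roots
of the ordered branches `c i` to a new vertex; `m = 0` gives the tree with one vertex. -/
inductive OTree : Type
  | node (m : ℕ) (c : Fin m → OTree) : OTree

namespace OTree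

/-- The ordered tree whose ordered list of branches is `l`. -/
def ofList (l : List OTree) : OTree := node l.length l.get

/-- The order (number of vertices). -/
def order : OTree → ℕ
  | node _ c => 1 + ∑ i, (c i).order

/-- The density `γ([τ₁,…,τₘ]) = |τ| γ(τ₁) ⋯ γ(τₘ)`. -/
def density : OTree → ℕ
  | node _ c => (1 + ∑ i, (c i).order) * ∏ i, (c i).density

/-- Two ordered trees are equivalent if they differ only by the ordering of the branches, at the
root and, recursively, inside the branches. -/
inductive Iso : OTree → OTree → Prop
  | node {m : ℕ} {c d : Fin m → OTree} (e : Equiv.Perm (Fin m)) (h : ∀ i, Iso (c i) (d (e i))) :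
      Iso (OTree.node m c) (OTree.node m d)

theorem Iso.refl (s : OTree) : Iso s s := by
  induction s with
  | node m c ih => exact Iso.node (Equiv.refl _) ih

theorem Iso.symm {s t : OTree} (h : Iso s t) : Iso t s := by
  induction h with
  | @node m c d e _ ih =>
    refine Iso.node e.symm fun i => ?_
    have := ih (e.symm i)
    rwa [e.apply_symm_apply] at this

theorem Iso.trans {s t u : OTree} (h : Iso s t) (h' : Iso t u) : Iso s u := by
  induction h generalizing u with
  | @node m c d e _ ih =>
    cases h' with
    | node e' h2 => exact Iso.node (e.trans e') fun i => ih i (h2 (e i))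

instance setoid : Setoid OTree := ⟨Iso, Iso.refl, Iso.symm, Iso.trans⟩

theorem Iso.order_eq {s t : OTree} (h : Iso s t) : s.order = t.order := by
  induction h with
  | @node m c d e _ ih =>
    simp only [order, ih]
    rw [Equiv.sum_comp e (fun i => (d i).order)]

theorem Iso.density_eq {s t : OTree} (h : Iso s t) : s.density = t.density := by
  induction h with
  | @node m c d e h' ih =>
    simp only [density, ih, fun i => (h' i).order_eq]
    rw [Equiv.sum_comp e (fun i => (d i).order), Equiv.prod_comp e (fun i => (d i).density)]

end OTree

/-- Unordered rooted trees: equivalence classes of ordered trees. -/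
def RTree : Type := Quotient OTree.setoid

/-- The unordered tree obtained from an ordered tree by neglecting the ordering. -/
def OTree.toRTree (t : OTree) : RTree := Quotient.mk OTree.setoid t

theorem OTree.Iso.toRTree_eq {s t : OTree} (h : OTree.Iso s t) : s.toRTree = t.toRTree :=
  Quotient.sound h

open Classical in
/-- The symmetry coefficient `σ([τ₁,…,τₘ]) = σ(τ₁) ⋯ σ(τₘ) · μ₁! μ₂! ⋯`, where `μ₁, μ₂, …` count
the branches that are equal as unordered trees. -/
noncomputable def OTree.symmetry : OTree → ℕ
  | .node _ c => (∏ i, (c i).symmetry) *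
      ∏ t ∈ Finset.univ.image (fun i => (c i).toRTree),
        (Finset.univ.filter fun i => (c i).toRTree = t).card.factorial

theorem OTree.Iso.symmetry_eq {s t : OTree} (h : OTree.Iso s t) : s.symmetry = t.symmetry := by
  classical
  induction h with
  | @node m c d e h' ih =>
    have hc : ∀ i, (c i).toRTree = (d (e i)).toRTree := fun i => (h' i).toRTree_eq
    simp only [symmetry, ih, hc]
    rw [Equiv.prod_comp e (fun i => (d i).symmetry)]
    congr 1
    have himg : Finset.univ.image (fun i => (d (e i)).toRTree)
        = Finset.univ.image (fun i => (d i).toRTree) := by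
      ext t
      simp only [Finset.mem_image, Finset.mem_univ, true_and]
      exact ⟨fun ⟨i, hi⟩ => ⟨e i, hi⟩, fun ⟨i, hi⟩ => ⟨e.symm i, by simpa using hi⟩⟩
    rw [himg]
    refine Finset.prod_congr rfl fun t _ => ?_
    congr 1
    refine Finset.card_bij (fun i _ => e i) ?_ ?_ ?_
    · intro i hi
      simpa using hi
    · intro i _ j _ hij
      exact e.injective hij
    · intro j hj
      exact ⟨e.symm j, by simpa using hj, by simp⟩

namespace RTree

/-- A chosen ordered tree that represents the unordered tree `t`. -/
noncomputable def rep (t : RTree) : OTree := Quotient.out t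

/-- The order (number of vertices) of an unordered tree. -/
def order (t : RTree) : ℕ := Quotient.lift OTree.order (fun _ _ h => OTree.Iso.order_eq h) t

/-- The density `γ` of an unordered tree. -/
def density (t : RTree) : ℕ := Quotient.lift OTree.density (fun _ _ h => OTree.Iso.density_eq h) t

/-- The symmetry coefficient `σ` of an unordered tree. -/
noncomputable def symmetry (t : RTree) : ℕ :=
  Quotient.lift OTree.symmetry (fun _ _ h => OTree.Iso.symmetry_eq h) t

end RTree

theorem OTree.finite_order_le (n : ℕ) : {t : OTree | t.order ≤ n}.Finite := by
  induction n with
  | zero =>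
    convert Set.finite_empty (α := OTree)
    ext t
    cases t
    simp [OTree.order]
  | succ n ih =>
    have hfin : (⋃ m ∈ Finset.range (n + 1),
        (OTree.node m) '' (Set.univ.pi fun _ : Fin m => {t : OTree | t.order ≤ n})).Finite :=
      Set.Finite.biUnion (Finset.finite_toSet _) fun m _ => (Set.Finite.pi fun _ => ih).image _
    refine hfin.subset ?_
    rintro ⟨m, c⟩ ht
    simp only [Set.mem_ofPred_eq, OTree.order] at ht
    have hpos : ∀ t : OTree, 1 ≤ t.order := by
      rintro ⟨m, c⟩
      simp [OTree.order]
    have hm : m ≤ ∑ i, (c i).order := by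
      calc m = ∑ _i : Fin m, 1 := by simp
        _ ≤ _ := Finset.sum_le_sum fun i _ => hpos (c i)
    refine Set.mem_biUnion (x := m) (by simp; omega) ⟨c, fun i _ => ?_, rfl⟩
    have := Finset.single_le_sum (f := fun i => (c i).order) (fun _ _ => Nat.zero_le _)
      (Finset.mem_univ i)
    simp only [Set.mem_ofPred_eq]
    omega

theorem RTree.finite_order_eq (n : ℕ) : {t : RTree | t.order = n}.Finite := by
  refine ((OTree.finite_order_le n).image OTree.toRTree).subset ?_
  intro t ht
  induction t using Quotient.inductionOn with
  | h s => exact ⟨s, le_of_eq ht, rfl⟩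

/-- The finite set of unordered trees with `n` vertices. -/
noncomputable def RTree.ofOrder (n : ℕ) : Finset RTree := (RTree.finite_order_eq n).toFinset

namespace OTree

/-- The partitions of an ordered tree: every edge is kept solid (`false`) or made dashed (`true`).
For `node m c`, the `i`-th component consists of the mark of the edge from the root to the branch
`c i` and of a partition of that branch. -/
def Partition : OTree → Type
  | node m c => (i : Fin m) → Bool × (c i).Partition

instance instFintypePartition : (t : OTree) → Fintype t.Partition
  | node m c =>
    letI : ∀ i : Fin m, Fintype (c i).Partition := fun i => instFintypePartition (c i)
    inferInstanceAs (Fintype ((i : Fin m) → Bool × (c i).Partition))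

/-- The subtree containing the root that remains after removing the dashed edges. -/
def rootPart : (t : OTree) → t.Partition → OTree
  | node m c, p => ofList (((List.finRange m).filter fun i => !(p i).1).map
      fun i => (c i).rootPart (p i).2)

/-- The subtrees not containing the root that remain after removing the dashed edges, as unordered
trees, with multiplicity. -/
def otherParts : (t : OTree) → t.Partition → Multiset RTree
  | node _ c, p => ∑ i, ((if (p i).1 then {((c i).rootPart (p i).2).toRTree} else 0)
      + (c i).otherParts (p i).2)

/-- The list of all subtrees that remain after removing the dashed edges. -/
def parts (t : OTree) (p : t.Partition) : Multiset RTree :=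
  (t.rootPart p).toRTree ::ₘ t.otherParts p

/-- The branches of the skeleton: the skeletons of the parts that are joined by a dashed edge to
some vertex of the part containing the root. -/
def skeletonBranches : (t : OTree) → t.Partition → List OTree
  | node m c, p => (List.finRange m).flatMap fun i =>
      if (p i).1 then [ofList ((c i).skeletonBranches (p i).2)]
      else (c i).skeletonBranches (p i).2

/-- The skeleton `χ(p)`: every remaining subtree is contracted to a vertex, and then the dashed
edges are made solid. -/
def skeleton (t : OTree) (p : t.Partition) : RTree := (ofList (t.skeletonBranches p)).toRTree

end OTree

/-- Coefficient maps `𝒯 ∪ {∅} → ℝ`; the empty tree is `none`. -/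
abbrev CoeffMap : Type := Option RTree → ℝ

/-- The substitution law `b ⋆ a`. -/
noncomputable def substitution (b a : CoeffMap) : CoeffMap
  | none => a none
  | some t => ∑ p : t.rep.Partition,
      a (some (t.rep.skeleton p)) * ((t.rep.parts p).map fun s => b (some s)).prod

/-- Formal power series in `h` whose coefficients are maps `E → E`; `G k` is the coefficient of
`h ^ k`. They represent `h`-dependent vector fields as well as `h`-dependent maps. -/
abbrev FormalSeries (E : Type*) : Type _ := ℕ → E → E

/-- The product `h G` of a formal series with the variable `h`. -/
def FormalSeries.hMul {E : Type*} [Zero E] (G : FormalSeries E) : FormalSeries E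
  | 0 => 0
  | k + 1 => G k

section BSeries

variable {E : Type*} [NormedAddCommGroup E] [NormedSpace ℝ E]

/-- The elementary differential
`F_f([τ₁,…,τₘ])(z) = f⁽ᵐ⁾(z)(F_f(τ₁)(z), …, F_f(τₘ)(z))` of a vector field. -/
noncomputable def OTree.elemDiff (f : E → E) : OTree → E → E
  | .node m c, z => iteratedFDeriv ℝ m f z fun i => (c i).elemDiff f z

/-- Elementary differentials of an unordered tree; for smooth `f` they do not depend on the ordering
of the branches. -/
noncomputable def RTree.elemDiff (f : E → E) (t : RTree) : E → E := t.rep.elemDiff f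

/-- The B-series `B_f(a,z) = a(∅) z + ∑ h^|τ| / σ(τ) a(τ) F_f(τ)(z)` as a formal power series
in `h`. -/
noncomputable def bSeries (f : E → E) (a : CoeffMap) : FormalSeries E := fun n z =>
  (if n = 0 then a none • z else 0)
    + ∑ t ∈ RTree.ofOrder n, (a (some t) / t.symmetry) • t.elemDiff f z

/-- The elementary differential of a formal `h`-dependent vector field `G = ∑ h^k G_k`, expanded in
powers of `h` by multilinearity: the coefficient of `h^k` of
`G⁽ᵐ⁾(z)(F_G(τ₁)(z), …, F_G(τₘ)(z))`. -/
noncomputable def OTree.formalElemDiff (G : FormalSeries E) : OTree → FormalSeries E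
  | .node m c => fun k z => ∑ κ ∈ Finset.Nat.antidiagonalTuple (m + 1) k,
      iteratedFDeriv ℝ m (G (κ 0)) z fun i => (c i).formalElemDiff G (κ i.succ) z

/-- For an `h`-independent field the formal elementary differential is the ordinary one. -/
theorem OTree.formalElemDiff_const (f : E → E) (t : OTree) (k : ℕ) (z : E) :
    t.formalElemDiff (fun j => if j = 0 then f else 0) k z
      = if k = 0 then t.elemDiff f z else 0 := by
  induction t generalizing k with
  | node m c ih =>
    simp only [formalElemDiff, ih]
    rcases Nat.eq_zero_or_pos k with rfl | hk
    · rw [Finset.Nat.antidiagonalTuple_zero_right]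
      simp [elemDiff]
    · rw [if_neg hk.ne']
      refine Finset.sum_eq_zero fun κ hκ => ?_
      rw [Finset.Nat.mem_antidiagonalTuple] at hκ
      by_cases h0 : κ 0 = 0
      · have : ∃ i : Fin m, κ i.succ ≠ 0 := by
          by_contra! h
          rw [Fin.sum_univ_succ] at hκ
          simp [h0, h] at hκ
          omega
        obtain ⟨i, hi⟩ := this
        exact ContinuousMultilinearMap.map_coord_zero _ i (by simp [hi])
      · simp [h0]

/-- Elementary differentials of a formal `h`-dependent vector field for an unordered tree. -/
noncomputable def RTree.formalElemDiff (G : FormalSeries E) (t : RTree) : FormalSeries E :=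
  t.rep.formalElemDiff G

/-- The B-series `B_G(a,z) = a(∅) z + ∑ h^|τ| / σ(τ) a(τ) F_G(τ)(z)` of a formal `h`-dependent vector
field, expanded in powers of `h`. -/
noncomputable def formalBSeries (G : FormalSeries E) (a : CoeffMap) : FormalSeries E := fun n z =>
  (if n = 0 then a none • z else 0)
    + ∑ q ∈ Finset.HasAntidiagonal.antidiagonal n, ∑ t ∈ RTree.ofOrder q.1,
        (a (some t) / t.symmetry) • t.formalElemDiff G q.2 z

/-- A one-step method, as an operator `G ↦ Φ_h^G` from formal `h`-dependent vector fields to formal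
`h`-dependent maps, has the B-series with coefficients `a` if `Φ_h^G(z) = B_G(a,z)` for all formal
vector fields `G` with smooth coefficients. -/
def HasBSeries (Φ : FormalSeries E → FormalSeries E) (a : CoeffMap) : Prop :=
  ∀ G : FormalSeries E, (∀ k, ContDiff ℝ ∞ (G k)) → Φ G = formalBSeries G a

/-- `z` is a solution of `ż = f(z)`, `z(t₀) = z₀` near `t₀`. -/
def IsLocalSolution (f : E → E) (t₀ : ℝ) (z₀ : E) (z : ℝ → E) : Prop :=
  z t₀ = z₀ ∧ ∀ᶠ t in 𝓝 t₀, HasDerivAt z (f (z t)) t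

end BSeries

/-! The heart is the substitution law `B_g(a,z) = B_f(b⋆a,z)`. Given it, the hypothesis turns the
coefficients into `1/γ(τ)`, and the resulting series has the Taylor coefficients of the solution
because both obey the recursion imposed by `ż = f(z)` (`IsLocalSolution.taylorCoeff_eq`).

The law is proved for each skeleton separately, hence for all `a` at once. Every tree `t` gets a
formal mark `x_t`, so that a forest (a multiset of trees) is a monomial. Let `X = ∑ x_t h^|t| / σ(t)
F_g(t)(z)` (`methodSeries`), and let `X'` be the sum over all partitioned trees of `f`, weighted by
`b` of their parts and marked by their skeletons (`skeletonSeries`). Both satisfy the same equation: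
the coefficient at `x_t` is the coefficient of the monomial of the branches of `t` in `hg(z + X)`.
Since `hg` starts at order `h`, this determines the series recursively in the power of `h`, so `X =
X'` (`methodSeries_eq_skeletonSeries`).

For `X` the equation is grafting of branches to a new root. For `X'` the partitioned trees are
sorted by the class `r` of the part containing the root, and those with a given `r` must add up to
`F_f(r)/σ(r)` evaluated at `z + X'`. To see this, mark the root parts too: `W(y) = ∑ y_r
F_f(r)(y)/σ(r)` (`markedField`) satisfies a grafting equation with right-hand side `f(y + W(y))`,
and the series `Y` of partitioned trees hanging from a root by a dashed or solid edge
(`branchSeries`) satisfies one with `f(z + Y)`. Expanding `f` at `z + X' + W(z + X')` is evaluating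
`f(y + W(y))` at `y = z + X'` (`formalTaylor_composedDisplacement`), so `Y = X' + W(z + X')` by
induction on the number of vertices.

All expansions are formal (`formalTaylor`), with exponents in a graded monoid; the product and
composition rules follow from the derivation that multiplies each coefficient by its degree.
Symmetry coefficients are handled by ordering the trees: weights `1/σ` on unordered trees become
weights `∏ 1/m!` over the vertices of ordered ones (`RTree.sum_ofOrder`). -/

/-! ### Symmetry of higher derivatives. -/

section Symmetry

variable {E F : Type*} [NormedAddCommGroup E] [NormedSpace ℝ E] [NormedAddCommGroup F]
  [NormedSpace ℝ F]

/-- The iterated derivatives of a smooth function are invariant under adjacent transpositions. -/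
theorem ContDiff.iteratedFDeriv_comp_adjacent_swap {f : E → F} (hf : ContDiff ℝ ∞ f) (n : ℕ)
    (i : Fin n) (z : E) (v : Fin (n + 1) → E) :
    iteratedFDeriv ℝ (n + 1) f z (v ∘ Equiv.swap i.castSucc i.succ)
      = iteratedFDeriv ℝ (n + 1) f z v := by
  induction n generalizing z with
  | zero => exact i.elim0
  | succ n ih =>
    induction i using Fin.cases with
    | zero =>
      -- With the last `n` vectors frozen this is a second derivative in the directions `w 0`, `w
      -- 1`, so the swap of the first two slots is symmetry of second derivatives.
      have key : ∀ w : Fin (n + 2) → E, iteratedFDeriv ℝ (n + 2) f z w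
          = fderiv ℝ (fderiv ℝ (fun x => iteratedFDeriv ℝ n f x (Fin.tail (Fin.tail w)))) z
              (w 0) (w 1) := by
        intro w
        have h1 : ∀ x, iteratedFDeriv ℝ (n + 1) f x (Fin.tail w)
            = fderiv ℝ (fun x => iteratedFDeriv ℝ n f x (Fin.tail (Fin.tail w))) x (w 1) := by
          intro x
          rw [iteratedFDeriv_succ_apply_left,
            fderiv_continuousMultilinear_apply_const_apply
              ((hf.differentiable_iteratedFDeriv (by exact_mod_cast ENat.natCast_lt_top n)) x)]
          rfl
        have hd : ContDiff ℝ ∞ (fun x => iteratedFDeriv ℝ n f x (Fin.tail (Fin.tail w))) :=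
          (ContinuousMultilinearMap.apply ℝ (fun _ : Fin n => E) F
            (Fin.tail (Fin.tail w))).contDiff.comp
              (hf.iteratedFDeriv_right (m := ∞) le_rfl)
        rw [iteratedFDeriv_succ_apply_left, ← fderiv_continuousMultilinear_apply_const_apply
              ((hf.differentiable_iteratedFDeriv (by exact_mod_cast ENat.natCast_lt_top (n+1))) z)]
        rw [funext h1, fderiv_clm_apply
          ((hd.fderiv_right (m := ∞) (by simp)).differentiable (by simp) z) (by fun_prop)]
        simp
      rw [key, key]
      have ht : Fin.tail (Fin.tail (v ∘ Equiv.swap (Fin.castSucc 0) (Fin.succ 0)))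
          = Fin.tail (Fin.tail v) := by
        funext j
        simp only [Fin.tail, Function.comp_apply]
        rw [Equiv.swap_apply_of_ne_of_ne]
        · exact Fin.succ_ne_zero _
        · intro h
          exact Fin.succ_ne_zero _ (Fin.succ_injective _ h)
      rw [ht]
      have hd : ContDiff ℝ ∞ (fun x => iteratedFDeriv ℝ n f x (Fin.tail (Fin.tail v))) :=
          (ContinuousMultilinearMap.apply ℝ (fun _ : Fin n => E) F
            (Fin.tail (Fin.tail v))).contDiff.comp
              (hf.iteratedFDeriv_right (m := ∞) le_rfl)
      have hs : IsSymmSndFDerivAt ℝ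
          (fun x => iteratedFDeriv ℝ n f x (Fin.tail (Fin.tail v))) z :=
        (hd.contDiffAt).isSymmSndFDerivAt (by simp; exact WithTop.coe_le_coe.2 le_top)
      have e0 : (v ∘ Equiv.swap (Fin.castSucc 0) (Fin.succ 0)) (0 : Fin (n + 2)) = v 1 := by
        simp
      have e1 : (v ∘ Equiv.swap (Fin.castSucc 0) (Fin.succ 0)) (1 : Fin (n + 2)) = v 0 := by
        simp
      rw [e0, e1]
      exact hs _ _
    | succ i =>
      -- The swap fixes slot 0: differentiate the induction hypothesis, valid at every point, in the
      -- direction `v 0`.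
      have h0 : (v ∘ Equiv.swap i.succ.castSucc i.succ.succ) 0 = v 0 := by
        simp only [Function.comp_apply]
        rw [Equiv.swap_apply_of_ne_of_ne]
        · simp [Fin.ext_iff]
        · exact (Fin.succ_ne_zero _).symm
      have ht : Fin.tail (v ∘ Equiv.swap i.succ.castSucc i.succ.succ)
          = Fin.tail v ∘ Equiv.swap i.castSucc i.succ := by
        funext j
        simp only [Fin.tail, Function.comp_apply]
        congr 1
        have := (Fin.succ_injective _).swap_apply i.castSucc i.succ j
        rw [← this, Fin.succ_castSucc]
      have hD : ∀ w : Fin (n + 2) → E, iteratedFDeriv ℝ (n + 2) f z w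
          = fderiv ℝ (fun x => iteratedFDeriv ℝ (n + 1) f x (Fin.tail w)) z (w 0) := by
        intro w
        rw [iteratedFDeriv_succ_apply_left, fderiv_continuousMultilinear_apply_const_apply
              ((hf.differentiable_iteratedFDeriv (by exact_mod_cast ENat.natCast_lt_top (n+1))) z)]
      rw [hD, hD, h0, ht]
      simp only [ih]

/-- The iterated derivatives of a smooth function are symmetric. -/
theorem ContDiff.iteratedFDeriv_comp_perm {f : E → F} (hf : ContDiff ℝ ∞ f) {n : ℕ} (z : E)
    (v : Fin n → E) (e : Equiv.Perm (Fin n)) :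
    iteratedFDeriv ℝ n f z (v ∘ e) = iteratedFDeriv ℝ n f z v := by
  cases n with
  | zero => congr 1; exact Subsingleton.elim _ _
  | succ n =>
    have he : e ∈ Submonoid.closure (Set.range fun i : Fin n => Equiv.swap i.castSucc i.succ) := by
      rw [Equiv.Perm.mclosure_swap_castSucc_succ]; trivial
    induction he using Submonoid.closure_induction generalizing v with
    | mem x hx =>
      obtain ⟨i, rfl⟩ := hx
      exact hf.iteratedFDeriv_comp_adjacent_swap n i z v
    | one => rfl
    | mul x y _ _ hx hy =>
      rw [Equiv.Perm.coe_mul, ← Function.comp_assoc, hy, hx]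

end Symmetry

/-! ### Reindexing of sums over decompositions of an exponent. -/

section Antidiagonal

open Finset hiding antidiagonal mem_antidiagonal
open Finset.HasAntidiagonal (antidiagonal mem_antidiagonal)

variable {M N : Type*} [AddCommMonoid M] [HasAntidiagonal M]
  [AddCommMonoid N]

theorem sum_finAntidiagonal_succ_snoc [DecidableEq M] (m : ℕ) (μ : M) (h : (Fin (m + 1) → M) → N) :
    ∑ κ ∈ finAntidiagonal (m + 1) μ, h κ
      = ∑ p ∈ antidiagonal μ, ∑ κ ∈ finAntidiagonal m p.1, h (Fin.snoc κ p.2) := by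
  rw [sum_sigma']
  refine sum_nbij' (fun κ => ⟨(∑ i, Fin.init κ i, κ (Fin.last m)), Fin.init κ⟩)
    (fun x => Fin.snoc x.2 x.1.2) ?_ ?_ ?_ ?_ ?_
  · intro κ hκ
    simp only [mem_finAntidiagonal, Fin.sum_univ_castSucc] at hκ
    simp [Fin.init, hκ]
  · rintro ⟨⟨x, y⟩, κ⟩ h
    simp only [mem_sigma, mem_antidiagonal, mem_finAntidiagonal] at h
    simp [Fin.sum_univ_castSucc, h.2, h.1]
  · intro κ _
    simp
  · rintro ⟨⟨x, y⟩, κ⟩ h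
    simp only [mem_sigma, mem_antidiagonal, mem_finAntidiagonal] at h
    simp [h.2]
  · intro κ _
    simp

theorem sum_finAntidiagonal_succ_cons [DecidableEq M] (m : ℕ) (μ : M) (h : (Fin (m + 1) → M) → N) :
    ∑ κ ∈ finAntidiagonal (m + 1) μ, h κ
      = ∑ p ∈ antidiagonal μ, ∑ κ ∈ finAntidiagonal m p.2, h (Fin.cons p.1 κ) := by
  rw [sum_sigma']
  refine sum_nbij' (fun κ => ⟨(κ 0, ∑ i, Fin.tail κ i), Fin.tail κ⟩)
    (fun x => Fin.cons x.1.1 x.2) ?_ ?_ ?_ ?_ ?_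
  · intro κ hκ
    simp only [mem_finAntidiagonal, Fin.sum_univ_succ] at hκ
    simp [Fin.tail, hκ]
  · rintro ⟨⟨x, y⟩, κ⟩ h
    simp only [mem_sigma, mem_antidiagonal, mem_finAntidiagonal] at h
    simp [Fin.sum_univ_succ, h.2, h.1]
  · intro κ _
    simp
  · rintro ⟨⟨x, y⟩, κ⟩ h
    simp only [mem_sigma, mem_antidiagonal, mem_finAntidiagonal] at h
    simp [h.2]
  · intro κ _
    simp

theorem finAntidiagonal_zero [DecidableEq M] (μ : M) :
    finAntidiagonal 0 μ = if μ = 0 then {Fin.elim0} else ∅ := by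
  ext κ
  split_ifs with h
  · simp [h, Subsingleton.elim κ Fin.elim0]
  · simp [Ne.symm h]

/-- Reassociation of sums over nested antidiagonals. -/
theorem sum_antidiagonal_assoc (μ : M) (h : M → M → M → N) :
    ∑ p ∈ antidiagonal μ, ∑ q ∈ antidiagonal p.1, h q.1 q.2 p.2
      = ∑ p ∈ antidiagonal μ, ∑ q ∈ antidiagonal p.2, h p.1 q.1 q.2 := by
  rw [sum_sigma', sum_sigma']
  refine sum_nbij' (fun x => ⟨(x.2.1, x.2.2 + x.1.2), (x.2.2, x.1.2)⟩)
    (fun x => ⟨(x.1.1 + x.2.1, x.2.2), (x.1.1, x.2.1)⟩) ?_ ?_ ?_ ?_ ?_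
  all_goals
    rintro ⟨⟨a, b⟩, ⟨c, d⟩⟩ h
    simp only [mem_sigma, mem_antidiagonal] at h
    obtain ⟨rfl, rfl⟩ := h
    simp [add_assoc]

theorem sum_antidiagonal_comm (μ : M) (h : M → M → N) :
    ∑ p ∈ antidiagonal μ, h p.1 p.2 = ∑ p ∈ antidiagonal μ, h p.2 p.1 := by
  refine sum_nbij' Prod.swap Prod.swap ?_ ?_ ?_ ?_ ?_ <;>
    simp [add_comm]

/-- The antidiagonal of a product of additive monoids. -/
instance Prod.instHasAntidiagonal {A B : Type*} [AddMonoid A] [AddMonoid B] [HasAntidiagonal A]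
    [HasAntidiagonal B] : HasAntidiagonal (A × B) where
  antidiagonal x := (antidiagonal x.1 ×ˢ antidiagonal x.2).map
    ⟨fun p => ((p.1.1, p.2.1), (p.1.2, p.2.2)), by rintro ⟨⟨_, _⟩, _, _⟩ ⟨⟨_, _⟩, _, _⟩; simp; tauto⟩
  mem_antidiagonal := by
    rintro ⟨a, b⟩ ⟨⟨c, d⟩, ⟨c', d'⟩⟩
    simp only [mem_map, mem_product, mem_antidiagonal, Prod.exists,
      Prod.mk.injEq, Prod.mk_add_mk]
    constructor
    · rintro ⟨_, _, _, _, ⟨h1, h2⟩, h⟩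
      cases h
      exact ⟨h1, h2⟩
    · rintro ⟨h1, h2⟩
      exact ⟨c, c', d, d', ⟨h1, h2⟩, rfl⟩

theorem sum_antidiagonal_prod {A B : Type*} [AddMonoid A] [AddMonoid B] [HasAntidiagonal A]
    [HasAntidiagonal B] (a : A) (b : B) (h : (A × B) × (A × B) → N) :
    ∑ p ∈ antidiagonal (a, b), h p = ∑ p ∈ antidiagonal a, ∑ q ∈ antidiagonal b,
      h ((p.1, q.1), (p.2, q.2)) := by
  change ∑ p ∈ Finset.map _ _, h p = _
  rw [sum_map, sum_product]
  rfl

/-- The antidiagonal of a multiset. -/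
noncomputable instance Multiset.instHasAntidiagonalFinset {α : Type*} :
    HasAntidiagonal (Multiset α) where
  antidiagonal s := by
    classical exact (Multiset.antidiagonal s).toFinset
  mem_antidiagonal := by
    rintro s ⟨a, b⟩
    simp

end Antidiagonal

/-! ### Smooth dependence of multilinear expressions. -/

section Smoothness

variable {E F G : Type*} [NormedAddCommGroup E] [NormedSpace ℝ E] [NormedAddCommGroup F]
  [NormedSpace ℝ F] [NormedAddCommGroup G] [NormedSpace ℝ G]

/-- Applying a smooth family of continuous multilinear maps to smooth arguments is smooth. -/
theorem ContDiff.continuousMultilinearMap_apply {m : ℕ}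
    {L : G → ContinuousMultilinearMap ℝ (fun _ : Fin m => E) F} {v : Fin m → G → E}
    (hL : ContDiff ℝ ∞ L) (hv : ∀ i, ContDiff ℝ ∞ (v i)) :
    ContDiff ℝ ∞ (fun y => L y fun i => v i y) := by
  induction m with
  | zero =>
    have h : ∀ y, L y (fun i => v i y) = L y 0 := fun y => by
      congr 1; exact Subsingleton.elim _ _
    simp only [h]
    exact (ContinuousMultilinearMap.apply ℝ (fun _ : Fin 0 => E) F 0).contDiff.comp hL
  | succ m ih =>
    have h : ∀ y, L y (fun i => v i y)
        = (L y).curryLeft (v 0 y) (fun i : Fin m => v i.succ y) := by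
      intro y
      rw [ContinuousMultilinearMap.curryLeft_apply]
      congr 1
      funext i
      refine Fin.cases ?_ (fun i => ?_) i <;> simp
    simp only [h]
    refine ih (L := fun y => (L y).curryLeft (v 0 y)) ?_ (fun i => hv i.succ)
    refine ContDiff.clm_apply ?_ (hv 0)
    let C : (E [×(m + 1)]→L[ℝ] F) ≃ₗᵢ[ℝ] (E →L[ℝ] E [×m]→L[ℝ] F) :=
      continuousMultilinearCurryLeftEquiv ℝ (fun _ : Fin (m + 1) => E) F
    have hC : ContDiff ℝ ∞ C := LinearIsometryEquiv.contDiff _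
    exact hC.comp hL

theorem ContDiff.contDiff_iteratedFDeriv {f : E → F} (hf : ContDiff ℝ ∞ f) (m : ℕ) :
    ContDiff ℝ ∞ (iteratedFDeriv ℝ m f) :=
  hf.iteratedFDeriv_right (m := ∞) le_rfl

end Smoothness

/-! ### Formal Taylor expansion: chain rule and product rule. -/

section FormalTaylor

open Finset hiding antidiagonal mem_antidiagonal
open Finset.HasAntidiagonal (antidiagonal mem_antidiagonal)

variable {M : Type*} [AddCommMonoid M] [HasAntidiagonal M] [DecidableEq M]
variable {E F : Type} [NormedAddCommGroup E] [NormedSpace ℝ E] [NormedAddCommGroup F]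
  [NormedSpace ℝ F]

/-- The coefficient of index `μ` in the formal expansion of `φ (z + ∑ u_μ)`, where the formal series
`u` with exponents in `M` has no terms of degree zero. -/
noncomputable def formalTaylor (d : M →+ ℕ) (z : E) (u : M → E) (φ : E → F) (μ : M) : F :=
  ∑ m ∈ range (d μ + 1), ((m.factorial : ℝ)⁻¹) •
    ∑ κ ∈ finAntidiagonal m μ, iteratedFDeriv ℝ m φ z fun i => u (κ i)

theorem degree_eq_of_mem_finAntidiagonal (d : M →+ ℕ) {m : ℕ} {μ : M} {κ : Fin m → M}
    (hκ : κ ∈ finAntidiagonal m μ) : d μ = ∑ i, d (κ i) := by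
  rw [mem_finAntidiagonal] at hκ
  rw [← hκ, map_sum]

theorem degree_le_of_mem_finAntidiagonal (d : M →+ ℕ) {m : ℕ} {μ : M} {κ : Fin m → M}
    (hκ : κ ∈ finAntidiagonal m μ) (i : Fin m) : d (κ i) ≤ d μ := by
  rw [degree_eq_of_mem_finAntidiagonal d hκ]
  exact single_le_sum (f := fun i => d (κ i)) (fun _ _ => Nat.zero_le _) (mem_univ i)

variable {d : M →+ ℕ} {u : M → E}

/-- With more factors than the total degree, some factor has degree zero, where `u` vanishes. Hence
the cutoff in `formalTaylor` loses nothing. -/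
theorem sum_iteratedFDeriv_eq_zero_of_degree_lt (hu : ∀ μ, d μ = 0 → u μ = 0) (z : E) (φ : E → F)
    {μ : M} {m : ℕ} (hm : d μ < m) :
    ∑ κ ∈ finAntidiagonal m μ, iteratedFDeriv ℝ m φ z (fun i => u (κ i)) = 0 := by
  refine sum_eq_zero fun κ hκ => ?_
  have h : ∃ i, d (κ i) = 0 := by
    by_contra! h
    have h1 : ∑ _i : Fin m, 1 ≤ ∑ i, d (κ i) :=
      sum_le_sum fun i _ => Nat.one_le_iff_ne_zero.2 (h i)
    rw [← degree_eq_of_mem_finAntidiagonal d hκ] at h1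
    simp at h1
    omega
  obtain ⟨i, hi⟩ := h
  exact ContinuousMultilinearMap.map_coord_zero _ i (hu _ hi)

theorem formalTaylor_eq_sum_range (hu : ∀ μ, d μ = 0 → u μ = 0) (z : E) (φ : E → F)
    {μ : M} {N : ℕ} (hN : d μ < N) :
    formalTaylor d z u φ μ = ∑ m ∈ range N, ((m.factorial : ℝ)⁻¹) •
      ∑ κ ∈ finAntidiagonal m μ, iteratedFDeriv ℝ m φ z fun i => u (κ i) := by
  rw [formalTaylor]
  refine sum_subset (range_subset_range.2 hN) fun m _ hm => ?_
  rw [sum_iteratedFDeriv_eq_zero_of_degree_lt hu, smul_zero]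
  simp at hm
  omega

/-- This triangularity is what makes the fixed point equations below recursions. -/
theorem formalTaylor_congr {u' : M → E} (z : E) (φ : E → F) {μ : M}
    (h : ∀ ν, d ν ≤ d μ → u ν = u' ν) : formalTaylor d z u φ μ = formalTaylor d z u' φ μ := by
  unfold formalTaylor
  refine sum_congr rfl fun m _ => congrArg _ (sum_congr rfl fun κ hκ => ?_)
  congr 1
  funext i
  exact h _ (degree_le_of_mem_finAntidiagonal d hκ i)

theorem formalTaylor_of_degree_eq_zero (z : E) (φ : E → F) {μ : M} (hμ : d μ = 0) :
    formalTaylor d z u φ μ = if μ = 0 then φ z else 0 := by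
  simp only [formalTaylor, hμ, zero_add, sum_range_one, finAntidiagonal_zero]
  split_ifs <;> simp

theorem formalTaylor_add (z : E) {φ ψ : E → F} (hφ : ContDiff ℝ ∞ φ) (hψ : ContDiff ℝ ∞ ψ)
    (μ : M) : formalTaylor d z u (fun y => φ y + ψ y) μ
      = formalTaylor d z u φ μ + formalTaylor d z u ψ μ := by
  simp only [formalTaylor, ← sum_add_distrib, ← smul_add]
  refine sum_congr rfl fun m _ => congrArg _ (sum_congr rfl fun κ _ => ?_)
  rw [fun_iteratedFDeriv_add_apply (hφ.contDiffAt.of_le (mod_cast le_top))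
    (hψ.contDiffAt.of_le (mod_cast le_top))]
  rfl

theorem formalTaylor_const_smul (z : E) {φ : E → F} (hφ : ContDiff ℝ ∞ φ) (c : ℝ)
    (μ : M) : formalTaylor d z u (fun y => c • φ y) μ = c • formalTaylor d z u φ μ := by
  simp only [formalTaylor, smul_sum]
  refine sum_congr rfl fun m _ => sum_congr rfl fun κ _ => ?_
  rw [iteratedFDeriv_const_smul_apply' (hφ.contDiffAt.of_le (mod_cast le_top)),
    smul_comm]
  rfl

theorem formalTaylor_zero (z : E) (μ : M) :
    formalTaylor d z u (fun _ => (0 : F)) μ = 0 := by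
  have h := formalTaylor_const_smul (d := d) (u := u) z (contDiff_const (c := (0 : F))) 0 μ
  simpa using h

theorem formalTaylor_sum {ι : Type*} (z : E) (s : Finset ι) {φ : ι → E → F}
    (hφ : ∀ i ∈ s, ContDiff ℝ ∞ (φ i)) (μ : M) :
    formalTaylor d z u (fun y => ∑ i ∈ s, φ i y) μ = ∑ i ∈ s, formalTaylor d z u (φ i) μ := by
  classical
  induction s using Finset.induction_on with
  | empty => simp [formalTaylor_zero]
  | insert i s hi ih =>
    simp only [sum_insert hi]
    rw [formalTaylor_add z (hφ i (mem_insert_self _ _))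
      (ContDiff.sum fun j hj => hφ j (mem_insert_of_mem hj)),
      ih fun j hj => hφ j (mem_insert_of_mem hj)]

theorem contDiff_formalTaylor {d : M →+ ℕ} {G : M → E → E} (hG : ∀ μ, ContDiff ℝ ∞ (G μ))
    {φ : E → F} (hφ : ContDiff ℝ ∞ φ) (μ : M) :
    ContDiff ℝ ∞ (fun y => formalTaylor d y (fun ν => G ν y) φ μ) := by
  unfold formalTaylor
  refine ContDiff.sum fun m _ => ContDiff.const_smul _ (ContDiff.sum fun κ _ => ?_)
  exact (hφ.contDiff_iteratedFDeriv m).continuousMultilinearMap_apply fun i => hG _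

/-- Additivity splits `e μ` into the sum of the `e (κ i)`; by symmetry of the derivative all `m + 1`
slots contribute equally, so only the last one is kept, with factor `m + 1`. -/
theorem smul_sum_iteratedFDeriv {φ : E → F} (hφ : ContDiff ℝ ∞ φ) (z : E) (e : M →+ ℕ) (m : ℕ)
    (μ : M) :
    (e μ : ℝ) • ∑ κ ∈ finAntidiagonal (m + 1) μ,
        iteratedFDeriv ℝ (m + 1) φ z (fun i => u (κ i))
      = ((m + 1 : ℕ) : ℝ) • ∑ p ∈ antidiagonal μ, (e p.2 : ℝ) •
        (∑ κ ∈ finAntidiagonal m p.1, iteratedFDeriv ℝ m (fderiv ℝ φ) z (fun i => u (κ i)))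
          (u p.2) := by
  have h1 : ∀ i : Fin (m + 1), ∑ κ ∈ finAntidiagonal (m + 1) μ, (e (κ i) : ℝ) •
        iteratedFDeriv ℝ (m + 1) φ z (fun i => u (κ i))
      = ∑ κ ∈ finAntidiagonal (m + 1) μ, (e (κ (Fin.last m)) : ℝ) •
        iteratedFDeriv ℝ (m + 1) φ z (fun i => u (κ i)) := by
    intro i
    refine sum_nbij' (fun κ => κ ∘ Equiv.swap i (Fin.last m))
      (fun κ => κ ∘ Equiv.swap i (Fin.last m)) ?_ ?_ ?_ ?_ ?_
    · intro κ hκ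
      rw [mem_finAntidiagonal] at hκ ⊢
      rw [← hκ]
      exact Equiv.sum_comp (Equiv.swap i (Fin.last m)) κ
    · intro κ hκ
      rw [mem_finAntidiagonal] at hκ ⊢
      rw [← hκ]
      exact Equiv.sum_comp (Equiv.swap i (Fin.last m)) κ
    · intro κ _
      funext j
      simp
    · intro κ _
      funext j
      simp
    · intro κ _
      have := hφ.iteratedFDeriv_comp_perm z (fun i => u (κ i)) (Equiv.swap i (Fin.last m))
      simp only [Function.comp_apply, Equiv.swap_apply_right]
      rw [← this]
      rfl
  have h2 : (e μ : ℝ) • ∑ κ ∈ finAntidiagonal (m + 1) μ,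
        iteratedFDeriv ℝ (m + 1) φ z (fun i => u (κ i))
      = ∑ i : Fin (m + 1), ∑ κ ∈ finAntidiagonal (m + 1) μ, (e (κ i) : ℝ) •
        iteratedFDeriv ℝ (m + 1) φ z (fun i => u (κ i)) := by
    rw [sum_comm, smul_sum]
    refine sum_congr rfl fun κ hκ => ?_
    rw [← sum_smul, degree_eq_of_mem_finAntidiagonal e hκ, Nat.cast_sum]
  rw [h2, sum_congr rfl fun i _ => h1 i, sum_const, card_univ, Fintype.card_fin,
    ← Nat.cast_smul_eq_nsmul ℝ, sum_finAntidiagonal_succ_snoc]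
  congr 1
  refine sum_congr rfl fun p _ => ?_
  rw [_root_.sum_apply, smul_sum]
  refine sum_congr rfl fun κ _ => ?_
  rw [iteratedFDeriv_succ_apply_right, Fin.snoc_last]
  congr 2
  · congr 1
    funext i
    simp [Fin.init]

/-- The chain rule for a derivation `e` of formal series that multiplies the coefficient of index
`μ` by `e μ`. -/
theorem smul_formalTaylor (hu : ∀ μ, d μ = 0 → u μ = 0) {φ : E → F} (hφ : ContDiff ℝ ∞ φ) (z : E)
    (e : M →+ ℕ) (μ : M) :
    (e μ : ℝ) • formalTaylor d z u φ μ
      = ∑ p ∈ antidiagonal μ, (e p.2 : ℝ) • formalTaylor d z u (fderiv ℝ φ) p.1 (u p.2) := by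
  have hR : ∀ p ∈ antidiagonal μ, (e p.2 : ℝ) • formalTaylor d z u (fderiv ℝ φ) p.1 (u p.2)
      = ∑ m ∈ range (d μ), ((m.factorial : ℝ)⁻¹) • (e p.2 : ℝ) •
        (∑ κ ∈ finAntidiagonal m p.1, iteratedFDeriv ℝ m (fderiv ℝ φ) z (fun i => u (κ i)))
          (u p.2) := by
    intro p hp
    rw [mem_antidiagonal] at hp
    -- Either `u p.2` vanishes, or `p.1` has smaller degree than `μ`; in both cases the range `d μ`
    -- serves for all `p`.
    by_cases h0 : d p.2 = 0
    · simp [hu _ h0]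
    · have hlt : d p.1 < d μ := by
        rw [← hp, map_add]
        omega
      rw [formalTaylor_eq_sum_range hu z _ hlt, _root_.sum_apply, smul_sum]
      refine sum_congr rfl fun m _ => ?_
      rw [smul_apply, smul_comm]
  rw [sum_congr rfl hR, sum_comm, formalTaylor, sum_range_succ', smul_add, finAntidiagonal_zero]
  have h0 : (e μ : ℝ) • (((Nat.factorial 0 : ℕ) : ℝ)⁻¹) •
      ∑ κ ∈ (if μ = 0 then {Fin.elim0} else ∅ : Finset (Fin 0 → M)),
        iteratedFDeriv ℝ 0 φ z (fun i => u (κ i)) = 0 := by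
    split_ifs with h
    · simp [h]
    · simp
  rw [h0, add_zero, smul_sum]
  refine sum_congr rfl fun m _ => ?_
  rw [smul_comm, smul_sum_iteratedFDeriv hφ, ← smul_sum, smul_smul]
  congr 1
  -- The factor `m + 1` from the choice of slot turns `1/(m+1)!` into `1/m!`.
  rw [Nat.factorial_succ]
  push_cast
  field_simp

/-- Multiplying by the degree acts as a derivation on both sides, and the chain rule reduces the
claim to the products of `φ` with `Dψ` and of `Dφ` with `ψ` in lower degree. The target spaces are
quantified inside because the induction passes to spaces of linear maps. -/
theorem formalTaylor_bilinear_of_degree_le (hu : ∀ μ, d μ = 0 → u μ = 0) (z : E) (n : ℕ) :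
    ∀ {G₁ G₂ F : Type} [NormedAddCommGroup G₁] [NormedSpace ℝ G₁] [NormedAddCommGroup G₂]
      [NormedSpace ℝ G₂] [NormedAddCommGroup F] [NormedSpace ℝ F] (B : G₁ →L[ℝ] G₂ →L[ℝ] F)
      {φ : E → G₁} {ψ : E → G₂} (_ : ContDiff ℝ ∞ φ) (_ : ContDiff ℝ ∞ ψ) (μ : M) (_ : d μ ≤ n),
      formalTaylor d z u (fun y => B (φ y) (ψ y)) μ
        = ∑ p ∈ antidiagonal μ, B (formalTaylor d z u φ p.1) (formalTaylor d z u ψ p.2) := by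
  induction n with
  | zero =>
    intro G₁ G₂ F _ _ _ _ _ _ B φ ψ hφ hψ μ hμ
    have h0 : d μ = 0 := by omega
    rw [formalTaylor_of_degree_eq_zero z _ h0]
    have h : ∀ p ∈ antidiagonal μ,
        B (formalTaylor d z u φ p.1) (formalTaylor d z u ψ p.2)
          = if p = 0 then B (φ z) (ψ z) else 0 := by
      intro p hp
      rw [mem_antidiagonal] at hp
      rw [← hp, map_add] at h0
      rw [formalTaylor_of_degree_eq_zero z φ (by omega : d p.1 = 0),
        formalTaylor_of_degree_eq_zero z ψ (by omega : d p.2 = 0)]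
      by_cases h1 : p.1 = 0 <;> by_cases h2 : p.2 = 0 <;> simp [Prod.ext_iff, h1, h2]
    rw [sum_congr rfl h, sum_ite_eq']
    simp [eq_comm]
  | succ n ih =>
    intro G₁ G₂ F _ _ _ _ _ _ B φ ψ hφ hψ μ hμ
    by_cases h0 : d μ = 0
    · exact ih B hφ hψ μ (by omega)
    have hφ' : ContDiff ℝ ∞ (fderiv ℝ φ) := hφ.fderiv_right le_rfl
    have hψ' : ContDiff ℝ ∞ (fderiv ℝ ψ) := hψ.fderiv_right le_rfl
    have hB : ContDiff ℝ ∞ (fun y => B (φ y) (ψ y)) :=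
      (B.contDiff.comp hφ).clm_apply hψ
    have hne : (d μ : ℝ) ≠ 0 := by exact_mod_cast h0
    refine smul_right_injective F hne ?_
    change (d μ : ℝ) • _ = (d μ : ℝ) • _
    rw [smul_formalTaylor hu hB]
    have hfd : fderiv ℝ (fun y => B (φ y) (ψ y)) = fun y =>
        B.precompR E (φ y) (fderiv ℝ ψ y) + B.precompL E (fderiv ℝ φ y) (ψ y) := by
      funext y
      exact B.fderiv_of_bilinear (hφ.differentiable (by simp) y) (hψ.differentiable (by simp) y)
    have hL : ∀ p ∈ antidiagonal μ,
        (d p.2 : ℝ) • formalTaylor d z u (fderiv ℝ fun y => B (φ y) (ψ y)) p.1 (u p.2)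
          = ∑ q ∈ antidiagonal p.1, (d p.2 : ℝ) •
              B (formalTaylor d z u φ q.1) (formalTaylor d z u (fderiv ℝ ψ) q.2 (u p.2))
            + ∑ q ∈ antidiagonal p.1, (d p.2 : ℝ) •
              B (formalTaylor d z u (fderiv ℝ φ) q.1 (u p.2)) (formalTaylor d z u ψ q.2) := by
      intro p hp
      rw [mem_antidiagonal] at hp
      by_cases hp2 : d p.2 = 0
      · simp [hp2]
      have hle : d p.1 ≤ n := by
        have : d p.1 + d p.2 = d μ := by rw [← hp, map_add]
        omega
      have hR : ContDiff ℝ ∞ (B.precompR E) :=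
        ContinuousLinearMap.contDiff (F := (E →L[ℝ] G₂) →L[ℝ] E →L[ℝ] F) _
      have hL : ContDiff ℝ ∞ (B.precompL E) :=
        ContinuousLinearMap.contDiff (F := G₂ →L[ℝ] E →L[ℝ] F) _
      have hs1 : ContDiff ℝ ∞ fun y => B.precompR E (φ y) (fderiv ℝ ψ y) :=
        (hR.comp hφ).clm_apply hψ'
      have hs2 : ContDiff ℝ ∞ fun y => B.precompL E (fderiv ℝ φ y) (ψ y) :=
        (hL.comp hφ').clm_apply hψ
      rw [hfd, formalTaylor_add z hs1 hs2, ih _ hφ hψ' p.1 hle, ih _ hφ' hψ p.1 hle]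
      simp [_root_.sum_apply, smul_sum]
    rw [sum_congr rfl hL, sum_add_distrib, smul_sum]
    have hRt : ∀ p ∈ antidiagonal μ,
        (d μ : ℝ) • B (formalTaylor d z u φ p.1) (formalTaylor d z u ψ p.2)
          = ∑ q ∈ antidiagonal p.2, (d q.2 : ℝ) •
              B (formalTaylor d z u φ p.1) (formalTaylor d z u (fderiv ℝ ψ) q.1 (u q.2))
            + ∑ q ∈ antidiagonal p.1, (d q.2 : ℝ) •
              B (formalTaylor d z u (fderiv ℝ φ) q.1 (u q.2)) (formalTaylor d z u ψ p.2) := by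
      intro p hp
      rw [mem_antidiagonal] at hp
      have h1 : (d μ : ℝ) = d p.2 + d p.1 := by rw [← hp, map_add]; push_cast; ring
      rw [h1, add_smul, ← map_smul, smul_formalTaylor hu hψ, ← smul_apply,
        ← map_smul, smul_formalTaylor hu hφ]
      simp [map_sum, _root_.sum_apply]
    rw [sum_congr rfl hRt, sum_add_distrib]
    -- The two halves of the Leibniz rule agree up to regrouping decompositions of `μ` into three
    -- exponents.
    congr 1
    · exact sum_antidiagonal_assoc μ fun a b c => (d c : ℝ) •
        B (formalTaylor d z u φ a) (formalTaylor d z u (fderiv ℝ ψ) b (u c))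
    · rw [sum_antidiagonal_assoc μ fun a b c => (d c : ℝ) •
        B (formalTaylor d z u (fderiv ℝ φ) a (u c)) (formalTaylor d z u ψ b),
        sum_antidiagonal_assoc μ fun a b c => (d b : ℝ) •
        B (formalTaylor d z u (fderiv ℝ φ) a (u b)) (formalTaylor d z u ψ c)]
      refine sum_congr rfl fun p _ => ?_
      exact sum_antidiagonal_comm p.2 fun a b => (d b : ℝ) •
        B (formalTaylor d z u (fderiv ℝ φ) p.1 (u b)) (formalTaylor d z u ψ a)

/-- Formal Taylor expansion is compatible with continuous bilinear maps. -/
theorem formalTaylor_bilinear (hu : ∀ μ, d μ = 0 → u μ = 0) (z : E)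
    {G₁ G₂ F : Type} [NormedAddCommGroup G₁] [NormedSpace ℝ G₁] [NormedAddCommGroup G₂]
    [NormedSpace ℝ G₂] [NormedAddCommGroup F] [NormedSpace ℝ F] (B : G₁ →L[ℝ] G₂ →L[ℝ] F)
    {φ : E → G₁} {ψ : E → G₂} (hφ : ContDiff ℝ ∞ φ) (hψ : ContDiff ℝ ∞ ψ) (μ : M) :
    formalTaylor d z u (fun y => B (φ y) (ψ y)) μ
      = ∑ p ∈ antidiagonal μ, B (formalTaylor d z u φ p.1) (formalTaylor d z u ψ p.2) :=
  formalTaylor_bilinear_of_degree_le hu z (d μ) B hφ hψ μ le_rfl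

end FormalTaylor

/-! ### Composition of formal displacements. -/

section Composition

open Finset hiding antidiagonal mem_antidiagonal
open Finset.HasAntidiagonal (antidiagonal mem_antidiagonal)

variable {M₁ M₂ : Type*} [AddCommMonoid M₁] [DecidableEq M₁]
  [AddCommMonoid M₂] [HasAntidiagonal M₂] [DecidableEq M₂]
variable {E : Type} [NormedAddCommGroup E] [NormedSpace ℝ E]

/-- The formal displacement of `z ↦ z + G(z)` composed with the displacement `z ↦ z + u`. -/
noncomputable def composedDisplacement (d₂ : M₂ →+ ℕ) (z : E) (u : M₂ → E) (G : M₁ → E → E)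
    (x : M₁ × M₂) : E :=
  (if x.1 = 0 then u x.2 else 0) + formalTaylor d₂ z u (G x.1) x.2

variable {d₁ : M₁ →+ ℕ} {d₂ : M₂ →+ ℕ} {u : M₂ → E} {G : M₁ → E → E}

theorem composedDisplacement_eq_zero (hd₁ : ∀ κ, d₁ κ = 0 → κ = 0)
    (hu : ∀ l, d₂ l = 0 → u l = 0) (hG0 : G 0 = 0) (z : E) (x : M₁ × M₂)
    (hx : d₁.coprod d₂ x = 0) : composedDisplacement d₂ z u G x = 0 := by
  rw [AddMonoidHom.coprod_apply] at hx
  have h1 : x.1 = 0 := hd₁ _ (by omega)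
  have h2 := hu x.2 (by omega)
  have h3 : formalTaylor d₂ z u (0 : E → E) x.2 = 0 := formalTaylor_zero z x.2
  simp [composedDisplacement, h1, h2, hG0, h3]

/-- As `d₁` vanishes only at zero, a decomposition of `(0, l)` has first components zero throughout,
and there the displacement is just `u`. -/
theorem formalTaylor_composedDisplacement_zero_left [HasAntidiagonal M₁] (hd₁ : ∀ κ, d₁ κ = 0 → κ = 0)
    (hG0 : G 0 = 0) (z : E) {F : Type} [NormedAddCommGroup F] [NormedSpace ℝ F] (f : E → F)
    (l : M₂) :
    formalTaylor (d₁.coprod d₂) z (composedDisplacement d₂ z u G) f (0, l)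
      = formalTaylor d₂ z u f l := by
  simp only [formalTaylor, AddMonoidHom.coprod_apply, map_zero, zero_add]
  refine sum_congr rfl fun m _ => congrArg _ ?_
  symm
  refine sum_nbij' (fun κ i => ((0 : M₁), κ i)) (fun κ i => (κ i).2) ?_ ?_ ?_ ?_ ?_
  · intro κ hκ
    rw [mem_finAntidiagonal] at hκ ⊢
    ext <;> simp [Prod.fst_sum, Prod.snd_sum, hκ]
  · intro κ hκ
    rw [mem_finAntidiagonal] at hκ ⊢
    rw [← Prod.snd_sum, hκ]
  · intro κ _
    rfl
  · intro κ hκ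
    rw [mem_finAntidiagonal] at hκ
    funext i
    have h1 : ∑ i, d₁ (κ i).1 = 0 := by
      rw [← map_sum, ← Prod.fst_sum, hκ, map_zero]
    have h2 : (κ i).1 = 0 := hd₁ _ (sum_eq_zero_iff.1 h1 i (mem_univ i))
    exact Prod.ext h2.symm rfl
  · intro κ _
    congr 1
    funext i
    simp only [composedDisplacement, hG0, if_true]
    have : formalTaylor d₂ z u (0 : E → E) (κ i) = 0 := formalTaylor_zero z (κ i)
    rw [this, add_zero]

/-- Expanding `f (y + G(y))` and then shifting `y = z + u` is the same as expanding
`f (z + u + G(z + u))`. -/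
theorem formalTaylor_composedDisplacement [HasAntidiagonal M₁] (hd₁ : ∀ κ, d₁ κ = 0 → κ = 0)
    (hu : ∀ l, d₂ l = 0 → u l = 0) (hG : ∀ κ, ContDiff ℝ ∞ (G κ)) (hG0 : G 0 = 0) (z : E)
    (n : ℕ) : ∀ {F : Type} [NormedAddCommGroup F] [NormedSpace ℝ F] {f : E → F}
      (_ : ContDiff ℝ ∞ f) (κ : M₁) (_ : d₁ κ ≤ n) (l : M₂),
      formalTaylor (d₁.coprod d₂) z (composedDisplacement d₂ z u G) f (κ, l)
        = formalTaylor d₂ z u (fun y => formalTaylor d₁ y (fun ν => G ν y) f κ) l := by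
  induction n with
  | zero =>
    intro F _ _ f hf κ hκ l
    obtain rfl : κ = 0 := hd₁ κ (by omega)
    rw [formalTaylor_composedDisplacement_zero_left hd₁ hG0]
    congr 1
    funext y
    rw [formalTaylor_of_degree_eq_zero y f (map_zero d₁), if_pos rfl]
  | succ n ih =>
    intro F _ _ f hf κ hκ l
    by_cases h0 : d₁ κ = 0
    · exact ih hf κ (by omega) l
    have hne : (d₁ κ : ℝ) ≠ 0 := by exact_mod_cast h0
    have hf' : ContDiff ℝ ∞ (fderiv ℝ f) := hf.fderiv_right le_rfl
    refine smul_right_injective F hne ?_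
    change (d₁ κ : ℝ) • _ = (d₁ κ : ℝ) • _
    -- The derivation counts only the first exponent. It kills the part `u` of the displacement and
    -- leaves `G(z + u)`, so the chain rule in `y`, followed by the product rule for the shift,
    -- gives the same recursion in `d₁ κ`.
    have hL := smul_formalTaylor (composedDisplacement_eq_zero hd₁ hu hG0 z) hf z
      (d₁.comp (AddMonoidHom.fst M₁ M₂)) (κ, l)
    simp only [AddMonoidHom.comp_apply, AddMonoidHom.coe_fst] at hL
    have hGu : ∀ y μ, d₁ μ = 0 → G μ y = 0 := fun y μ h => by rw [hd₁ μ h, hG0]; rfl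
    rw [hL, sum_antidiagonal_prod, ← formalTaylor_const_smul z (contDiff_formalTaylor hG hf κ)]
    simp only [fun y => smul_formalTaylor (hGu y) hf y d₁ κ]
    have hcd := fun μ : M₁ => contDiff_formalTaylor (d := d₁) hG hf' μ
    rw [formalTaylor_sum z _ fun p _ => ContDiff.const_smul _ ((hcd p.1).clm_apply (hG p.2))]
    refine sum_congr rfl fun p hp => ?_
    rw [formalTaylor_const_smul z ((hcd p.1).clm_apply (hG p.2))]
    by_cases hp2 : d₁ p.2 = 0
    · simp [hp2]
    rw [← smul_sum]
    congr 1
    have hb := formalTaylor_bilinear hu z (ContinuousLinearMap.id ℝ (E →L[ℝ] F)) (hcd p.1)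
      (hG p.2) l
    simp only [ContinuousLinearMap.id_apply] at hb
    rw [hb]
    refine sum_congr rfl fun q _ => ?_
    have hle : d₁ p.1 ≤ n := by
      rw [mem_antidiagonal] at hp
      have : d₁ p.1 + d₁ p.2 = d₁ κ := by rw [← hp, map_add]
      omega
    have hp0 : p.2 ≠ 0 := fun h => hp2 (by rw [h, map_zero])
    rw [ih hf' p.1 hle q.1]
    simp [composedDisplacement, hp0]

end Composition

/-! ### Orderings of a tree and the symmetry coefficient. -/

section TreeCounting

noncomputable instance RTree.instDecidableEq : DecidableEq RTree := Classical.decEq _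

/-- The multiset of the branches of an ordered tree, as unordered trees. -/
def OTree.branchClasses : OTree → Multiset RTree
  | .node _ c => ∑ i, {(c i).toRTree}

theorem OTree.branchClasses_node {m : ℕ} (c : Fin m → OTree) :
    (OTree.node m c).branchClasses = ∑ i, {(c i).toRTree} := rfl

/-- Two families with the same multiset of values differ by a permutation. -/
theorem exists_equiv_of_sum_singleton_eq {ι κ α : Type*} [Fintype ι] [Fintype κ] {f : ι → α}
    {g : κ → α} (h : ∑ i, ({f i} : Multiset α) = ∑ j, {g j}) :
    ∃ e : ι ≃ κ, ∀ i, g (e i) = f i := by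
  classical
  have hc : ∀ a, Fintype.card {i // f i = a} = Fintype.card {j // g j = a} := by
    intro a
    have := congrArg (Multiset.count a) h
    simpa [Multiset.count_sum', Multiset.count_singleton, Fintype.card_subtype, eq_comm] using this
  exact ⟨Equiv.ofFiberEquiv fun a => (Fintype.equivOfCardEq (hc a)),
    fun i => Equiv.ofFiberEquiv_map _ i⟩

theorem OTree.toRTree_eq_iff {s t : OTree} : s.toRTree = t.toRTree ↔ OTree.Iso s t :=
  ⟨fun h => Quotient.exact h, fun h => h.toRTree_eq⟩

/-- Makes equality of unordered trees a statement about multisets, so that forests can serve as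
additive exponents. -/
theorem OTree.toRTree_eq_iff_branchClasses {s t : OTree} :
    s.toRTree = t.toRTree ↔ s.branchClasses = t.branchClasses := by
  rw [OTree.toRTree_eq_iff]
  constructor
  · intro h
    cases h with
    | @node m c d e h =>
      simp only [branchClasses]
      rw [← Equiv.sum_comp e fun i => ({(d i).toRTree} : Multiset RTree)]
      exact Finset.sum_congr rfl fun i _ => by rw [(h i).toRTree_eq]
  · rcases s with ⟨m, c⟩
    rcases t with ⟨n, d⟩
    intro h
    simp only [branchClasses] at h
    obtain ⟨e, he⟩ := exists_equiv_of_sum_singleton_eq h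
    obtain rfl : m = n := by simpa using Fintype.card_congr e
    exact OTree.Iso.node e fun i => OTree.toRTree_eq_iff.1 (he i).symm

/-- The multiset of the branches of an unordered tree. -/
def RTree.branchClasses (t : RTree) : Multiset RTree :=
  Quotient.lift OTree.branchClasses
    (fun _ _ h => OTree.toRTree_eq_iff_branchClasses.1 (OTree.Iso.toRTree_eq h)) t

theorem OTree.branchClasses_toRTree (s : OTree) : s.toRTree.branchClasses = s.branchClasses := rfl

theorem OTree.toRTree_eq_iff_eq_branchClasses {s : OTree} {t : RTree} :
    s.toRTree = t ↔ t.branchClasses = s.branchClasses := by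
  obtain ⟨t, rfl⟩ : ∃ t' : OTree, t'.toRTree = t := ⟨_, Quotient.out_eq t⟩
  rw [OTree.branchClasses_toRTree, eq_comm (a := t.branchClasses)]
  exact OTree.toRTree_eq_iff_branchClasses

theorem OTree.order_toRTree (s : OTree) : s.toRTree.order = s.order := rfl

theorem OTree.symmetry_toRTree (s : OTree) : s.toRTree.symmetry = s.symmetry := rfl

theorem OTree.density_toRTree (s : OTree) : s.toRTree.density = s.density := rfl

theorem RTree.toRTree_rep (t : RTree) : t.rep.toRTree = t := Quotient.out_eq t

theorem OTree.one_le_order (s : OTree) : 1 ≤ s.order := by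
  cases s
  simp [OTree.order]

theorem RTree.one_le_order (t : RTree) : 1 ≤ t.order := by
  rw [← t.toRTree_rep]
  exact t.rep.one_le_order

/-- The product over all vertices of the factorial of the number of branches. -/
def OTree.branchFactorial : OTree → ℕ
  | .node m c => m.factorial * ∏ i, (c i).branchFactorial

theorem OTree.branchFactorial_pos (s : OTree) : 0 < s.branchFactorial := by
  induction s with
  | node m c ih => exact Nat.mul_pos m.factorial_pos (Finset.prod_pos fun i _ => ih i)

theorem OTree.symmetry_pos (s : OTree) : 0 < s.symmetry := by
  induction s with
  | node m c ih =>
    exact Nat.mul_pos (Finset.prod_pos fun i _ => ih i)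
      (Finset.prod_pos fun i _ => Nat.factorial_pos _)

/-- The product of the `μ_j!` is the order of the group of permutations that preserve the classes of
the branches. -/
theorem OTree.symmetry_node {m : ℕ} (c : Fin m → OTree) :
    (OTree.node m c).symmetry = (∏ i, (c i).symmetry) *
      Nat.card {g : Equiv.Perm (Fin m) // (fun i => (c i).toRTree) ∘ g = fun i => (c i).toRTree} := by
  classical
  rw [Nat.card_eq_fintype_card, DomMulAct.stabilizer_card', OTree.symmetry]
  congr 1
  refine Finset.prod_congr ?_ fun t _ => ?_
  · ext
    simp
  · rw [Fintype.card_subtype]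

/-- The ordered trees that differ from `node m c` by the ordering of the branches. -/
noncomputable def OTree.isoNodeEquiv {m : ℕ} (c : Fin m → OTree) :
    {t : OTree // OTree.Iso t (OTree.node m c)} ≃
      {d : Fin m → OTree // ∃ e : Equiv.Perm (Fin m), ∀ i, OTree.Iso (d i) (c (e i))} where
  toFun t := ⟨fun i => match t with
      | ⟨.node _ d, h⟩ => d (Fin.cast (by cases h; rfl) i), by
    rcases t with ⟨_, h⟩
    cases h with
    | @node _ d _ e h => exact ⟨e, h⟩⟩
  invFun d := ⟨OTree.node m d.1, by
    obtain ⟨e, he⟩ := d.2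
    exact OTree.Iso.node e he⟩
  left_inv := by
    rintro ⟨_, h⟩
    cases h
    rfl
  right_inv d := rfl

/-- Ordered trees with a matching of their branches to the branches of `node m c`. -/
noncomputable def OTree.matchingEquiv {m : ℕ} (c : Fin m → OTree) :
    (Σ e : Equiv.Perm (Fin m), ∀ i, {t : OTree // OTree.Iso t (c (e i))}) ≃
      {d : Fin m → OTree // ∃ e : Equiv.Perm (Fin m), ∀ i, OTree.Iso (d i) (c (e i))} ×
      {g : Equiv.Perm (Fin m) // (fun i => (c i).toRTree) ∘ g = fun i => (c i).toRTree} where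
  toFun x :=
    -- The chosen matching depends only on the family of trees; any other matching differs from it
    -- by a permutation preserving the branch classes.
    have h : ∃ e : Equiv.Perm (Fin m), ∀ i, OTree.Iso (x.2 i).1 (c (e i)) :=
      ⟨x.1, fun i => (x.2 i).2⟩
    (⟨fun i => (x.2 i).1, h⟩, ⟨x.1 * h.choose⁻¹, by
      funext i
      have h1 := (x.2 (h.choose⁻¹ i)).2.toRTree_eq
      have h2 := (h.choose_spec (h.choose⁻¹ i)).toRTree_eq
      rw [show h.choose (h.choose⁻¹ i) = i from h.choose.apply_symm_apply i] at h2
      exact h1.symm.trans h2⟩)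
  invFun y := ⟨y.2.1 * y.1.2.choose, fun i => ⟨y.1.1 i, by
    have h1 := (y.1.2.choose_spec i).toRTree_eq
    have h2 := congrFun y.2.2 (y.1.2.choose i)
    exact OTree.toRTree_eq_iff.1 (h1.trans h2.symm)⟩⟩
  left_inv := by
    rintro ⟨e, d⟩
    refine Sigma.ext ?_ ?_
    · simp
    · refine Function.hfunext rfl ?_
      intro i j hij
      cases hij
      simp only
      congr 1
      · simp
      · exact proof_irrel_heq _ _
  right_inv := by
    rintro ⟨d, g⟩
    refine Prod.ext ?_ ?_
    · rfl
    · apply Subtype.ext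
      simp

instance OTree.finite_iso (s : OTree) : Finite {t : OTree // OTree.Iso t s} :=
  ((OTree.finite_order_le s.order).subset fun _ ht => (OTree.Iso.order_eq ht).le).to_subtype

/-- The number of orderings of an unordered tree. -/
theorem OTree.card_iso_mul_symmetry (s : OTree) :
    Nat.card {t : OTree // OTree.Iso t s} * s.symmetry = s.branchFactorial := by
  induction s with
  | node m c ih =>
    -- Double counting: `m!` times the product of the numbers of orderings of the branches equals
    -- the number of orderings of the tree times the order of the stabilizer.
    have h := Nat.card_congr (OTree.matchingEquiv c)
    rw [Nat.card_prod, ← Nat.card_congr (OTree.isoNodeEquiv c), Nat.card_sigma] at h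
    simp only [Nat.card_pi] at h
    rw [Finset.sum_congr rfl fun e _ =>
      Equiv.prod_comp e fun i => Nat.card {t : OTree // OTree.Iso t (c i)}] at h
    rw [OTree.symmetry_node, mul_left_comm, ← h, OTree.branchFactorial]
    simp only [← ih, Finset.prod_mul_distrib, Finset.sum_const, Finset.card_univ,
      Fintype.card_perm, Fintype.card_fin, smul_eq_mul]
    ring

/-- The finite set of ordered trees with at most `n` vertices. -/
noncomputable def OTree.upTo (n : ℕ) : Finset OTree := (OTree.finite_order_le n).toFinset

theorem OTree.mem_upTo {n : ℕ} {s : OTree} : s ∈ OTree.upTo n ↔ s.order ≤ n := by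
  simp [OTree.upTo]

theorem RTree.mem_ofOrder {n : ℕ} {t : RTree} : t ∈ RTree.ofOrder n ↔ t.order = n := by
  simp [RTree.ofOrder]

/-- A sum over unordered trees, weighted by the symmetry coefficients, is a sum over ordered
trees. -/
theorem RTree.sum_ofOrder {V : Type*} [AddCommGroup V] [Module ℝ V] (n : ℕ) (x : OTree → V)
    (hx : ∀ s t, OTree.Iso s t → x s = x t) :
    ∑ t ∈ RTree.ofOrder n, ((t.symmetry : ℝ)⁻¹) • x t.rep
      = ∑ s ∈ (OTree.upTo n).filter fun s => s.order = n, ((s.branchFactorial : ℝ)⁻¹) • x s := by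
  -- Grouped by class, each fiber has `branchFactorial / σ` members with equal weights, which leaves
  -- `1/σ`.
  rw [← Finset.sum_fiberwise_of_maps_to (s := (OTree.upTo n).filter fun s => s.order = n)
    (g := OTree.toRTree) (t := RTree.ofOrder n)
    (fun s hs => RTree.mem_ofOrder.2 (Finset.mem_filter.1 hs).2)
    (fun s => ((s.branchFactorial : ℝ)⁻¹) • x s)]
  refine Finset.sum_congr rfl fun t ht => ?_
  rw [RTree.mem_ofOrder] at ht
  have hiso : ∀ s : OTree, s.toRTree = t ↔ OTree.Iso s t.rep := fun s => by
    rw [← OTree.toRTree_eq_iff, t.toRTree_rep]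
  have hsym : t.symmetry = t.rep.symmetry := by
    rw [← OTree.symmetry_toRTree, t.toRTree_rep]
  have hα : ∀ s, OTree.Iso s t.rep → s.branchFactorial = t.rep.branchFactorial := by
    intro s hs
    rw [← OTree.card_iso_mul_symmetry, ← OTree.card_iso_mul_symmetry, hs.symmetry_eq]
    congr 1
    exact Nat.card_congr (Equiv.subtypeEquivRight fun r =>
      ⟨fun h => h.trans hs, fun h => h.trans hs.symm⟩)
  have hcard : (((OTree.upTo n).filter fun s => s.order = n).filter
      fun s => s.toRTree = t).card = Nat.card {s : OTree // OTree.Iso s t.rep} := by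
    rw [Nat.subtype_card]
    intro s
    simp only [Finset.mem_filter, OTree.mem_upTo, hiso]
    refine ⟨fun h => h.2, fun h => ?_⟩
    have : s.order = n := by
      rw [h.order_eq, ← ht, ← OTree.order_toRTree, t.toRTree_rep]
    exact ⟨⟨this.le, this⟩, h⟩
  rw [Finset.sum_congr rfl (g := fun _ => ((t.rep.branchFactorial : ℝ)⁻¹) • x t.rep)]
  · rw [Finset.sum_const, hcard, ← Nat.cast_smul_eq_nsmul ℝ, smul_smul, hsym]
    congr 1
    have h1 := OTree.card_iso_mul_symmetry t.rep
    have h2 := t.rep.branchFactorial_pos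
    have h3 := t.rep.symmetry_pos
    rw [← h1] at h2 ⊢
    have h4 : 0 < Nat.card {s : OTree // OTree.Iso s t.rep} := Nat.pos_of_mul_pos_right h2
    push_cast
    field_simp
  · intro s hs
    have h := (hiso s).1 (Finset.mem_filter.1 hs).2
    rw [hx _ _ h, hα s h]

end TreeCounting

/-! ### Elementary differentials of smooth and of formal fields. -/

section ElementaryDifferentials

open Finset hiding antidiagonal mem_antidiagonal
open Finset.HasAntidiagonal (antidiagonal mem_antidiagonal)

variable {E : Type} [NormedAddCommGroup E] [NormedSpace ℝ E]

theorem OTree.contDiff_elemDiff {f : E → E} (hf : ContDiff ℝ ∞ f) (s : OTree) :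
    ContDiff ℝ ∞ (s.elemDiff f) := by
  induction s with
  | node m c ih =>
    simp only [funext fun z => OTree.elemDiff.eq_1 f z m c]
    exact (hf.contDiff_iteratedFDeriv m).continuousMultilinearMap_apply ih

theorem OTree.Iso.elemDiff_eq {f : E → E} (hf : ContDiff ℝ ∞ f) {s t : OTree}
    (h : OTree.Iso s t) (z : E) : s.elemDiff f z = t.elemDiff f z := by
  induction h with
  | @node m c d e _ ih =>
    simp only [OTree.elemDiff, ih]
    exact hf.iteratedFDeriv_comp_perm z (fun i => (d i).elemDiff f z) e

theorem OTree.Iso.formalElemDiff_eq {G : FormalSeries E} (hG : ∀ k, ContDiff ℝ ∞ (G k))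
    {s t : OTree} (h : OTree.Iso s t) (k : ℕ) (z : E) :
    s.formalElemDiff G k z = t.formalElemDiff G k z := by
  induction h generalizing k with
  | @node m c d e _ ih =>
    simp only [OTree.formalElemDiff, ih]
    refine sum_nbij' (fun κ => Fin.cons (κ 0) fun i => κ (e.symm i).succ)
      (fun κ => Fin.cons (κ 0) fun i => κ (e i).succ) ?_ ?_ ?_ ?_ ?_
    · intro κ hκ
      rw [Nat.mem_antidiagonalTuple] at hκ ⊢
      rw [← hκ, Fin.sum_univ_succ, Fin.sum_univ_succ]
      simp only [Fin.cons_zero, Fin.cons_succ]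
      rw [Equiv.sum_comp e.symm fun i => κ i.succ]
    · intro κ hκ
      rw [Nat.mem_antidiagonalTuple] at hκ ⊢
      rw [← hκ, Fin.sum_univ_succ, Fin.sum_univ_succ]
      simp only [Fin.cons_zero, Fin.cons_succ]
      rw [Equiv.sum_comp e fun i => κ i.succ]
    · intro κ _
      funext i
      refine Fin.cases ?_ (fun i => ?_) i <;> simp
    · intro κ _
      funext i
      refine Fin.cases ?_ (fun i => ?_) i <;> simp
    · intro κ _
      simp only [Fin.cons_zero, Fin.cons_succ]
      rw [← (hG (κ 0)).iteratedFDeriv_comp_perm z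
        (fun i => (d i).formalElemDiff G (κ (e.symm i).succ) z) e]
      congr 1
      funext i
      simp

/-- The coefficient of `h ^ n` in `h ^ |τ| F_G(τ)`. -/
noncomputable def OTree.scaledElemDiff (G : FormalSeries E) (s : OTree) (n : ℕ) (z : E) : E :=
  if s.order ≤ n then s.formalElemDiff G (n - s.order) z else 0

theorem OTree.scaledElemDiff_of_lt (G : FormalSeries E) {s : OTree} {n : ℕ} (h : n < s.order)
    (z : E) : s.scaledElemDiff G n z = 0 :=
  if_neg (not_le.2 h)

/-- `h ^ |τ| F_G(τ)` is the elementary differential of the field `h G`. -/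
theorem OTree.scaledElemDiff_node (G : FormalSeries E) {m : ℕ} (c : Fin m → OTree) (n : ℕ)
    (z : E) :
    (OTree.node m c).scaledElemDiff G n z
      = ∑ p ∈ antidiagonal n, ∑ κ ∈ finAntidiagonal m p.2,
          iteratedFDeriv ℝ m (G.hMul p.1) z fun i => (c i).scaledElemDiff G (κ i) z := by
  have hR := (sum_finAntidiagonal_succ_cons m n fun κ : Fin (m + 1) → ℕ =>
    iteratedFDeriv ℝ m (G.hMul (κ 0)) z fun i => (c i).scaledElemDiff G (κ i.succ) z).symm
  simp only [Fin.cons_zero, Fin.cons_succ] at hR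
  rw [hR]
  -- `o` holds the minimal exponents: 1 for `hG` and the order of each branch. Terms not above `o`
  -- vanish, and the others are shifted by `o`.
  set o : Fin (m + 1) → ℕ := Fin.cons 1 fun i => (c i).order with ho
  have hord : (OTree.node m c).order = ∑ i, o i := by
    rw [Fin.sum_univ_succ]
    simp [ho, OTree.order]
  have hzero : ∀ κ : Fin (m + 1) → ℕ, ¬ (o ≤ κ) →
      (iteratedFDeriv ℝ m (G.hMul (κ 0)) z fun i => (c i).scaledElemDiff G (κ i.succ) z) = 0 := by
    intro κ hκ
    simp only [Pi.le_def, not_forall, not_le] at hκ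
    obtain ⟨i, hi⟩ := hκ
    refine Fin.cases (fun hi => ?_) (fun i hi => ?_) i hi
    · have : κ 0 = 0 := by simpa [ho] using hi
      rw [this]
      simp [FormalSeries.hMul, iteratedFDeriv_zero]
    · exact ContinuousMultilinearMap.map_coord_zero _ i
        (OTree.scaledElemDiff_of_lt G (by simpa [ho] using hi) z)
  by_cases hle : (OTree.node m c).order ≤ n
  · rw [OTree.scaledElemDiff, if_pos hle, OTree.formalElemDiff]
    refine sum_of_injOn (fun κ => κ + o) (fun _ _ _ _ h => add_right_cancel h) ?_ ?_ ?_
    · intro κ hκ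
      rw [mem_coe, Nat.mem_antidiagonalTuple] at hκ
      simp only [mem_coe, mem_finAntidiagonal, Pi.add_apply, sum_add_distrib, hκ, ← hord]
      omega
    · intro κ hκ hn
      refine hzero κ fun hoκ => hn ⟨κ - o, ?_, tsub_add_cancel_of_le hoκ⟩
      rw [mem_finAntidiagonal] at hκ
      rw [mem_coe, Nat.mem_antidiagonalTuple, hord, ← hκ]
      simp only [Pi.sub_apply]
      rw [sum_tsub_distrib _ fun i _ => hoκ i]
    · intro κ _
      simp [ho, OTree.scaledElemDiff, FormalSeries.hMul]
  · rw [OTree.scaledElemDiff, if_neg hle]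
    symm
    refine sum_eq_zero fun κ hκ => hzero κ fun hoκ => hle ?_
    rw [mem_finAntidiagonal] at hκ
    rw [hord, ← hκ]
    exact sum_le_sum fun i _ => hoκ i

end ElementaryDifferentials

/-! ### Formal Taylor expansion as grafting of trees. -/

section TreeSums

open Finset hiding antidiagonal mem_antidiagonal
open Finset.HasAntidiagonal (antidiagonal mem_antidiagonal)

variable {M : Type*} [AddCommMonoid M] [HasAntidiagonal M] [DecidableEq M]
variable {E F : Type} [NormedAddCommGroup E] [NormedSpace ℝ E] [NormedAddCommGroup F]
  [NormedSpace ℝ F]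

/-- The contribution of an ordered tree to the formal Taylor expansion of `φ` in a formal series
that is a sum over ordered trees. -/
noncomputable def OTree.graftTerm (w : OTree → M → E) (z : E) (φ : E → F) (μ : M) : OTree → F
  | .node m c => ((m.factorial : ℝ)⁻¹) • ∑ κ ∈ finAntidiagonal m μ,
      iteratedFDeriv ℝ m φ z fun i => w (c i) (κ i)

variable {d : M →+ ℕ} {w : OTree → M → E}

theorem OTree.graftTerm_eq_zero (hw : ∀ s μ, d μ < s.order → w s μ = 0) (z : E) (φ : E → F)
    {μ : M} {s : OTree} (hs : d μ + 1 < s.order) : s.graftTerm w z φ μ = 0 := by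
  rcases s with ⟨m, c⟩
  rw [OTree.graftTerm, sum_eq_zero, smul_zero]
  intro κ hκ
  have h : ∃ i, d (κ i) < (c i).order := by
    by_contra! h
    have := sum_le_sum fun i (_ : i ∈ univ) => h i
    rw [← degree_eq_of_mem_finAntidiagonal d hκ] at this
    rw [OTree.order] at hs
    omega
  obtain ⟨i, hi⟩ := h
  exact ContinuousMultilinearMap.map_coord_zero _ i (hw _ _ hi)

/-- The formal Taylor expansion in a sum over ordered trees is a sum over ordered trees. -/
theorem formalTaylor_tree_sum (hw : ∀ s μ, d μ < s.order → w s μ = 0) (z : E) (φ : E → F)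
    (μ : M) {N : ℕ} (hN : d μ + 1 ≤ N) :
    formalTaylor d z (fun ν => ∑ s ∈ OTree.upTo (d ν), w s ν) φ μ
      = ∑ s ∈ OTree.upTo N, s.graftTerm w z φ μ := by
  have h1 : ∀ ν, d ν ≤ N → ∑ s ∈ OTree.upTo (d ν), w s ν = ∑ s ∈ OTree.upTo N, w s ν := by
    intro ν hν
    refine sum_subset (fun s hs => ?_) fun s _ hs => ?_
    · rw [OTree.mem_upTo] at hs ⊢
      omega
    · rw [OTree.mem_upTo] at hs
      exact hw _ _ (by omega)
  rw [formalTaylor_congr (u' := fun ν => ∑ s ∈ OTree.upTo N, w s ν) z φ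
    fun ν hν => h1 ν (by omega)]
  have h2 : formalTaylor d z (fun ν => ∑ s ∈ OTree.upTo N, w s ν) φ μ
      = ∑ x ∈ (range (d μ + 1)).sigma fun m => Fintype.piFinset fun _ : Fin m => OTree.upTo N,
        (OTree.node x.1 x.2).graftTerm w z φ μ := by
    rw [sum_sigma]
    refine sum_congr rfl fun m _ => ?_
    simp only [OTree.graftTerm]
    rw [← smul_sum, sum_comm]
    congr 1
    refine sum_congr rfl fun κ _ => ?_
    exact ContinuousMultilinearMap.map_sum_finset _ (fun i s => w s (κ i)) fun _ => OTree.upTo N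
  rw [h2]
  symm
  -- The new root accounts for the extra vertex: trees with more than `d μ + 1` vertices contribute
  -- nothing. The other side ranges over tuples of branches and likewise has only zero terms outside
  -- this set.
  have hsub : ∑ s ∈ OTree.upTo N, s.graftTerm w z φ μ
      = ∑ s ∈ OTree.upTo (d μ + 1), s.graftTerm w z φ μ := by
    symm
    refine sum_subset (fun s hs => ?_) fun s _ hs => ?_
    · rw [OTree.mem_upTo] at hs ⊢
      omega
    · rw [OTree.mem_upTo] at hs
      exact OTree.graftTerm_eq_zero hw z φ (by omega)
  rw [hsub]
  let e : OTree → Σ m, (Fin m → OTree) := fun s => match s with | .node m c => ⟨m, c⟩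
  refine sum_of_injOn e ?_ ?_ ?_ ?_
  · rintro ⟨m, c⟩ _ ⟨n, c'⟩ _ h
    cases h
    rfl
  · rintro ⟨m, c⟩ hs
    rw [mem_coe, OTree.mem_upTo, OTree.order] at hs
    have hm : m ≤ ∑ i, (c i).order := by
      calc m = ∑ _i : Fin m, 1 := by simp
        _ ≤ _ := sum_le_sum fun i _ => (c i).one_le_order
    rw [mem_coe, mem_sigma, mem_range, Fintype.mem_piFinset]
    refine ⟨by change m < _; omega, fun i => ?_⟩
    have := single_le_sum (f := fun i => (c i).order) (fun _ _ => Nat.zero_le _) (mem_univ i)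
    rw [OTree.mem_upTo]
    change (c i).order ≤ N
    omega
  · rintro ⟨m, c⟩ _ hn
    refine OTree.graftTerm_eq_zero hw z φ ?_
    by_contra! h
    exact hn ⟨OTree.node m c, by rw [mem_coe, OTree.mem_upTo]; exact h, rfl⟩
  · rintro ⟨m, c⟩ _
    rfl

/-- A multilinear map applied to formal series given by finite families of monomials. -/
theorem sum_finAntidiagonal_map_monomials {m : ℕ}
    (L : ContinuousMultilinearMap ℝ (fun _ : Fin m => E) F) {I : Fin m → Type*}
    [∀ i, Fintype (I i)] (wt : ∀ i, I i → M) (x : ∀ i, I i → E) (μ : M) :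
    ∑ κ ∈ finAntidiagonal m μ, L (fun i => ∑ q : I i, if wt i q = κ i then x i q else 0)
      = ∑ r : ∀ i, I i, if ∑ i, wt i (r i) = μ then L (fun i => x i (r i)) else 0 := by
  simp only [ContinuousMultilinearMap.map_sum]
  rw [sum_comm]
  refine sum_congr rfl fun r _ => ?_
  have h : ∀ κ : Fin m → M, L (fun i => if wt i (r i) = κ i then x i (r i) else 0)
      = if κ = fun i => wt i (r i) then L (fun i => x i (r i)) else 0 := by
    intro κ
    split_ifs with h
    · simp [h]
    · obtain ⟨i, hi⟩ : ∃ i, κ i ≠ wt i (r i) := by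
        by_contra! h'
        exact h (funext h')
      exact L.map_coord_zero i (if_neg hi.symm)
  simp only [h, sum_ite_eq', mem_finAntidiagonal]

end TreeSums

/-! ### Grafting of decorated trees and the marked field. -/

section DecoratedTreeSums

open Finset hiding antidiagonal mem_antidiagonal
open Finset.HasAntidiagonal (antidiagonal mem_antidiagonal)

variable {M : Type*} [AddCommMonoid M] [HasAntidiagonal M] [DecidableEq M]
variable {E : Type} [NormedAddCommGroup E] [NormedSpace ℝ E]

theorem OTree.inv_factorial_smul_iteratedFDeriv (f : E → E) (z : E) {m : ℕ} (c : Fin m → OTree)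
    (r : Fin m → ℝ) :
    ((m.factorial : ℝ)⁻¹) • iteratedFDeriv ℝ m f z
        (fun i => (((c i).branchFactorial : ℝ)⁻¹ * r i) • (c i).elemDiff f z)
      = (((OTree.node m c).branchFactorial : ℝ)⁻¹ * ∏ i, r i) • (OTree.node m c).elemDiff f z := by
  rw [ContinuousMultilinearMap.map_smul_univ, smul_smul, OTree.elemDiff, OTree.branchFactorial,
    prod_mul_distrib, prod_inv_distrib]
  congr 1
  push_cast
  rw [mul_inv]
  ring

/-- Decorations of the branches are chosen independently: exponents add, coefficients multiply, and
the Taylor factor `1/m!` completes the branch factorial of the grafted tree. -/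
theorem OTree.graftTerm_decorated {I : OTree → Type*} [∀ s, Fintype (I s)] (wt : ∀ s, I s → M)
    (r : ∀ s, I s → ℝ) (f : E → E) (z : E) (μ : M) {m : ℕ} (c : Fin m → OTree) :
    (OTree.node m c).graftTerm (fun s ν => ∑ q : I s, if wt s q = ν then
        ((s.branchFactorial : ℝ)⁻¹ * r s q) • s.elemDiff f z else 0) z f μ
      = ∑ q : ∀ i, I (c i), if ∑ i, wt (c i) (q i) = μ then
        (((OTree.node m c).branchFactorial : ℝ)⁻¹ * ∏ i, r (c i) (q i)) •
          (OTree.node m c).elemDiff f z else 0 := by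
  rw [OTree.graftTerm, sum_finAntidiagonal_map_monomials (iteratedFDeriv ℝ m f z)
    (fun i => wt (c i)), smul_sum]
  refine sum_congr rfl fun q _ => ?_
  rw [smul_ite, smul_zero, OTree.inv_factorial_smul_iteratedFDeriv f z c fun i => r (c i) (q i)]

/-- The number of vertices of a forest. -/
noncomputable def forestOrder : Multiset RTree →+ ℕ :=
  Multiset.sumAddMonoidHom.comp (Multiset.mapAddMonoidHom RTree.order)

theorem forestOrder_singleton (t : RTree) : forestOrder {t} = t.order := by
  simp [forestOrder]

theorem forestOrder_cons (t : RTree) (κ : Multiset RTree) :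
    forestOrder (t ::ₘ κ) = t.order + forestOrder κ := by
  simp [forestOrder]

theorem eq_zero_of_forestOrder_eq_zero (κ : Multiset RTree) (h : forestOrder κ = 0) : κ = 0 := by
  induction κ using Multiset.induction_on with
  | empty => rfl
  | cons t κ _ =>
    have := t.one_le_order
    rw [← Multiset.singleton_add, map_add, forestOrder_singleton] at h
    omega

theorem OTree.order_eq_forestOrder (s : OTree) : s.order = 1 + forestOrder s.branchClasses := by
  cases s
  simp [OTree.order, OTree.branchClasses, map_sum, forestOrder_singleton, OTree.order_toRTree]

theorem RTree.order_eq_forestOrder (t : RTree) : t.order = 1 + forestOrder t.branchClasses := by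
  rw [← t.toRTree_rep, OTree.order_toRTree, OTree.branchClasses_toRTree,
    OTree.order_eq_forestOrder]

/-- The sum of `1 / σ(τ) F_f(τ)` over all unordered trees, each marked by a formal variable. -/
noncomputable def markedField (f : E → E) (κ : Multiset RTree) (z : E) : E :=
  ∑ s ∈ OTree.upTo (forestOrder κ),
    if {s.toRTree} = κ then ((s.branchFactorial : ℝ)⁻¹) • s.elemDiff f z else 0

theorem contDiff_markedField {f : E → E} (hf : ContDiff ℝ ∞ f) (κ : Multiset RTree) :
    ContDiff ℝ ∞ (markedField f κ) := by
  refine ContDiff.sum fun s _ => ?_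
  split_ifs
  · exact (OTree.contDiff_elemDiff hf s).const_smul _
  · exact contDiff_const

theorem markedField_eq_zero (f : E → E) {κ : Multiset RTree} (h : ∀ t, κ ≠ {t}) :
    markedField f κ = 0 := by
  funext z
  exact sum_eq_zero fun s _ => if_neg (h _).symm

theorem markedField_zero (f : E → E) : markedField f 0 = 0 :=
  markedField_eq_zero f fun t h => Multiset.singleton_ne_zero t h.symm

/-- The grafting equation of the marked field: joining the forest of branches of `t` to a new root
gives exactly the orderings of `t`. -/
theorem formalTaylor_markedField (f : E → E) (z : E) (t : RTree) :
    formalTaylor forestOrder z (fun κ => markedField f κ z) f t.branchClasses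
      = markedField f {t} z := by
  have hw : ∀ (s : OTree) (κ : Multiset RTree), forestOrder κ < s.order →
      (∑ _q : Unit, if {s.toRTree} = κ then
        ((s.branchFactorial : ℝ)⁻¹ * 1) • s.elemDiff f z else 0) = 0 := by
    intro s κ h
    rw [sum_eq_zero]
    intro _ _
    refine if_neg fun h' => ?_
    rw [← h', forestOrder_singleton, OTree.order_toRTree] at h
    exact lt_irrefl _ h
  have h := formalTaylor_tree_sum hw z f t.branchClasses le_rfl
  simp only [univ_unique, sum_singleton, mul_one] at h
  simp only [markedField]
  rw [h, forestOrder_singleton, t.order_eq_forestOrder, add_comm 1]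
  refine sum_congr rfl fun s _ => ?_
  rcases s with ⟨m, c⟩
  have hg := OTree.graftTerm_decorated (I := fun _ => Unit) (fun s _ => ({s.toRTree} : Multiset RTree))
    (fun _ _ => 1) f z t.branchClasses c
  simp only [univ_unique, sum_singleton, mul_one, prod_const_one] at hg
  rw [hg, ← OTree.branchClasses_node]
  refine if_congr ?_ rfl rfl
  rw [Multiset.singleton_inj, OTree.toRTree_eq_iff_eq_branchClasses, eq_comm]

end DecoratedTreeSums

/-! ### Partitions, root parts and skeletons, independent of the ordering. -/

section Partitions

open Finset hiding antidiagonal mem_antidiagonal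

namespace OTree

theorem branchClasses_ofList (l : List OTree) :
    (ofList l).branchClasses = ((l.map OTree.toRTree : List RTree) : Multiset RTree) := by
  rw [ofList, branchClasses_node]
  induction l with
  | nil => rfl
  | cons a l ih =>
    rw [List.map_cons, ← Multiset.cons_coe, ← ih, ← Multiset.singleton_add]
    exact Fin.sum_univ_succ _

/-- The class of the part that contains the root. -/
def rootClass (s : OTree) (p : s.Partition) : RTree := (s.rootPart p).toRTree

/-- The branches of the skeleton as unordered trees. -/
def skeletonForest (s : OTree) (p : s.Partition) : Multiset RTree :=
  (((s.skeletonBranches p).map OTree.toRTree : List RTree) : Multiset RTree)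

theorem skeleton_eq_iff {s : OTree} {p : s.Partition} {t : RTree} :
    s.skeleton p = t ↔ t.branchClasses = s.skeletonForest p := by
  rw [skeleton, toRTree_eq_iff_eq_branchClasses, branchClasses_ofList]
  rfl

theorem branchClasses_skeleton (s : OTree) (p : s.Partition) :
    (s.skeleton p).branchClasses = s.skeletonForest p :=
  skeleton_eq_iff.1 rfl

theorem branchClasses_rootClass_node {m : ℕ} (c : Fin m → OTree) (p : (node m c).Partition) :
    ((node m c).rootClass p).branchClasses
      = ∑ i, if (p i).1 then 0 else {(c i).rootClass (p i).2} := by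
  have h : ∀ l : List (Fin m),
      (((((l.filter fun i => !(p i).1).map fun i => (c i).rootPart (p i).2).map
        OTree.toRTree) : List RTree) : Multiset RTree)
      = (l.map fun i => if (p i).1 then 0 else {(c i).rootClass (p i).2}).sum := by
    intro l
    induction l with
    | nil => rfl
    | cons i l ih =>
      rw [List.map_cons, List.sum_cons, ← ih]
      cases hi : (p i).1
      · simp [hi, rootClass]
      · simp [hi]
  rw [rootClass, branchClasses_toRTree, rootPart, branchClasses_ofList, h, Fin.sum_univ_def]

theorem skeletonForest_node {m : ℕ} (c : Fin m → OTree) (p : (node m c).Partition) :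
    (node m c).skeletonForest p
      = ∑ i, if (p i).1 then {(c i).skeleton (p i).2} else (c i).skeletonForest (p i).2 := by
  have h : ∀ l : List (Fin m),
      ((((l.flatMap fun i => if (p i).1 then [ofList ((c i).skeletonBranches (p i).2)]
      else (c i).skeletonBranches (p i).2).map OTree.toRTree) : List RTree) : Multiset RTree)
      = (l.map fun i => if (p i).1 then {(c i).skeleton (p i).2}
        else (c i).skeletonForest (p i).2).sum := by
    intro l
    induction l with
    | nil => rfl
    | cons i l ih =>
      rw [List.map_cons, List.sum_cons, ← ih, List.flatMap_cons, List.map_append,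
        ← Multiset.coe_add]
      cases hi : (p i).1
      · simp [skeletonForest]
      · simp [skeleton]
  rw [skeletonForest, skeletonBranches, h, Fin.sum_univ_def]

theorem otherParts_node {m : ℕ} (c : Fin m → OTree) (p : (node m c).Partition) :
    (node m c).otherParts p = ∑ i, ((if (p i).1 then {(c i).rootClass (p i).2} else 0)
      + (c i).otherParts (p i).2) := rfl

theorem order_rootClass_add (s : OTree) (p : s.Partition) :
    (s.rootClass p).order + forestOrder (s.otherParts p) = s.order := by
  induction s with
  | node m c ih =>
    rw [RTree.order_eq_forestOrder, branchClasses_rootClass_node, otherParts_node, order, add_assoc,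
      ← map_add, ← sum_add_distrib, map_sum]
    congr 1
    refine sum_congr rfl fun i _ => ?_
    rw [← ih i (p i).2]
    cases (p i).1 <;> simp [forestOrder_cons]

/-- Equivalent ordered trees have the same partitions. -/
theorem Iso.exists_partitionEquiv {s t : OTree} (h : Iso s t) :
    ∃ ε : s.Partition ≃ t.Partition, ∀ p, t.rootClass (ε p) = s.rootClass p ∧
      t.otherParts (ε p) = s.otherParts p ∧ t.skeletonForest (ε p) = s.skeletonForest p := by
  induction h with
  | @node m c d e _ ih =>
    choose ε hε using ih
    obtain ⟨η, hη⟩ : ∃ η : (OTree.node m c).Partition ≃ (OTree.node m d).Partition,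
        ∀ (p : (OTree.node m c).Partition) (i : Fin m), η p (e i) = ((p i).1, ε i (p i).2) :=
      ⟨Equiv.piCongr e fun i => (Equiv.refl Bool).prodCongr (ε i),
        fun _ _ => Equiv.piCongr_apply_apply _ _ _ _⟩
    have hr : ∀ p i, (d (e i)).rootClass (η p (e i)).2 = (c i).rootClass (p i).2 := by
      intro p i
      rw [hη]
      exact (hε i (p i).2).1
    have ho : ∀ p i, (d (e i)).otherParts (η p (e i)).2 = (c i).otherParts (p i).2 := by
      intro p i
      rw [hη]
      exact (hε i (p i).2).2.1
    have hk : ∀ p i, (d (e i)).skeletonForest (η p (e i)).2 = (c i).skeletonForest (p i).2 := by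
      intro p i
      rw [hη]
      exact (hε i (p i).2).2.2
    have hs : ∀ p i, (d (e i)).skeleton (η p (e i)).2 = (c i).skeleton (p i).2 := by
      intro p i
      rw [skeleton_eq_iff, hk, branchClasses_skeleton]
    have hb : ∀ p i, (η p (e i)).1 = (p i).1 := fun p i => by rw [hη]
    refine ⟨η, fun p => ⟨?_, ?_, ?_⟩⟩
    · rw [rootClass, toRTree_eq_iff_eq_branchClasses, ← branchClasses_toRTree]
      change _ = ((OTree.node m d).rootClass (η p)).branchClasses
      rw [branchClasses_rootClass_node, branchClasses_rootClass_node]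
      symm
      rw [← Equiv.sum_comp e]
      exact sum_congr rfl fun i _ => by rw [hb p i, hr p i]
    · rw [otherParts_node, otherParts_node, ← Equiv.sum_comp e]
      exact sum_congr rfl fun i _ => by rw [hb p i, hr p i, ho p i]
    · rw [skeletonForest_node, skeletonForest_node, ← Equiv.sum_comp e]
      exact sum_congr rfl fun i _ => by rw [hb p i, hs p i, hk p i]

/-- The product of the coefficients of the parts that do not contain the root. -/
noncomputable def otherCoeff (b : CoeffMap) (s : OTree) (p : s.Partition) : ℝ :=
  ((s.otherParts p).map fun t => b (some t)).prod

/-- The substitution law for an ordered tree. -/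
noncomputable def substitution (b a : CoeffMap) (s : OTree) : ℝ :=
  ∑ p : s.Partition, a (some (s.skeleton p)) * (b (some (s.rootClass p)) * s.otherCoeff b p)

theorem otherCoeff_node (b : CoeffMap) {m : ℕ} (c : Fin m → OTree) (p : (node m c).Partition) :
    (node m c).otherCoeff b p = ∏ i, (if (p i).1 then b (some ((c i).rootClass (p i).2)) else 1)
      * (c i).otherCoeff b (p i).2 := by
  simp only [otherCoeff]
  rw [otherParts_node]
  have h1 : ∀ S : Finset (Fin m), (Multiset.map (fun t => b (some t))
      (∑ i ∈ S, ((if (p i).1 then {(c i).rootClass (p i).2} else 0)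
        + (c i).otherParts (p i).2))).prod
      = ∏ i ∈ S, (if (p i).1 then b (some ((c i).rootClass (p i).2)) else 1)
        * (Multiset.map (fun t => b (some t)) ((c i).otherParts (p i).2)).prod := by
    intro S
    induction S using Finset.induction_on with
    | empty => simp
    | insert i S hi ih =>
      rw [sum_insert hi, prod_insert hi, ← ih, Multiset.map_add, Multiset.prod_add,
        Multiset.map_add, Multiset.prod_add]
      congr 2
      cases (p i).1 <;> simp
  exact h1 univ

theorem Iso.substitution_eq {s t : OTree} (h : Iso s t) (b a : CoeffMap) :
    s.substitution b a = t.substitution b a := by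
  obtain ⟨ε, hε⟩ := h.exists_partitionEquiv
  rw [substitution, substitution, ← Equiv.sum_comp ε]
  refine sum_congr rfl fun p _ => ?_
  obtain ⟨h1, h2, h3⟩ := hε p
  have h4 : t.skeleton (ε p) = s.skeleton p := by
    rw [skeleton_eq_iff, h3, branchClasses_skeleton]
  rw [otherCoeff, otherCoeff, h1, h2, h4]

theorem substitution_toRTree (b a : CoeffMap) (s : OTree) :
    _root_.substitution b a (some s.toRTree) = s.substitution b a := by
  have h : Iso s.toRTree.rep s := toRTree_eq_iff.1 s.toRTree.toRTree_rep
  rw [← h.substitution_eq, _root_.substitution, substitution]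
  refine sum_congr rfl fun p _ => ?_
  rw [parts, Multiset.map_cons, Multiset.prod_cons]
  rfl

end OTree

end Partitions

/-! ### The series of partitioned trees and its fixed point equation. -/

section Substitution

open Finset hiding antidiagonal mem_antidiagonal
open Finset.HasAntidiagonal (antidiagonal mem_antidiagonal)

variable {E : Type} [NormedAddCommGroup E] [NormedSpace ℝ E]

/-- The exponents of the power of `h` and of the marks of the branches of the skeleton. -/
abbrev SkeletonExponent : Type := ℕ × Multiset RTree

/-- The degree in `h`. -/
abbrev hDegree : SkeletonExponent →+ ℕ := AddMonoidHom.fst ℕ (Multiset RTree)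

/-- The number of all vertices. -/
noncomputable abbrev vertexDegree : Multiset RTree × SkeletonExponent →+ ℕ :=
  forestOrder.coprod hDegree

namespace OTree

/-- The exponent of a partitioned tree that is attached to a root by a dashed (`true`) or a solid
(`false`) edge. -/
noncomputable def branchExponent (s : OTree) : Bool × s.Partition → Multiset RTree × SkeletonExponent
  | (true, p) => (0, s.order, {s.skeleton p})
  | (false, p) => ({s.rootClass p}, forestOrder (s.otherParts p), s.skeletonForest p)

/-- The coefficient of a partitioned tree that is attached to a root by a dashed (`true`) or a solid
(`false`) edge. -/
noncomputable def branchCoeff (b : CoeffMap) (s : OTree) : Bool × s.Partition → ℝ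
  | (true, p) => b (some (s.rootClass p)) * s.otherCoeff b p
  | (false, p) => s.otherCoeff b p

theorem vertexDegree_branchExponent (s : OTree) (q : Bool × s.Partition) :
    vertexDegree (s.branchExponent q) = s.order := by
  rcases q with ⟨_ | _, p⟩
  · simp only [branchExponent, AddMonoidHom.coprod_apply, forestOrder_singleton,
      AddMonoidHom.coe_fst]
    exact s.order_rootClass_add p
  · simp [branchExponent]

/-- Solid branches extend the root part and pass on their skeleton branches; a dashed branch adds
one part and one skeleton branch. The power of `h` does not count the vertices of the root part. -/
theorem sum_branchExponent {m : ℕ} (c : Fin m → OTree) (p : (node m c).Partition) :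
    ∑ i, (c i).branchExponent (p i) = (((node m c).rootClass p).branchClasses,
      forestOrder ((node m c).otherParts p), (node m c).skeletonForest p) := by
  rw [branchClasses_rootClass_node, otherParts_node, skeletonForest_node, map_sum]
  refine Prod.ext ?_ (Prod.ext ?_ ?_)
  · rw [Prod.fst_sum]
    refine sum_congr rfl fun i _ => ?_
    rcases p i with ⟨_ | _, p⟩ <;> rfl
  · rw [Prod.snd_sum, Prod.fst_sum]
    refine sum_congr rfl fun i _ => ?_
    rcases p i with ⟨_ | _, p⟩
    · simp [branchExponent]
    · simp only [branchExponent, if_true, map_add, forestOrder_singleton]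
      exact ((c i).order_rootClass_add p).symm
  · rw [Prod.snd_sum, Prod.snd_sum]
    refine sum_congr rfl fun i _ => ?_
    rcases p i with ⟨_ | _, p⟩ <;> simp [branchExponent]

theorem prod_branchCoeff (b : CoeffMap) {m : ℕ} (c : Fin m → OTree) (p : (node m c).Partition) :
    ∏ i, (c i).branchCoeff b (p i) = (node m c).otherCoeff b p := by
  rw [otherCoeff_node]
  refine prod_congr rfl fun i _ => ?_
  rcases p i with ⟨_ | _, p⟩ <;> simp [branchCoeff]

/-- The contribution of an ordered tree to `branchSeries`. -/
noncomputable def branchTerm (b : CoeffMap) (f : E → E) (z : E) (s : OTree)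
    (ν : Multiset RTree × SkeletonExponent) : E :=
  ∑ q : Bool × s.Partition, if s.branchExponent q = ν then
    ((s.branchFactorial : ℝ)⁻¹ * s.branchCoeff b q) • s.elemDiff f z else 0

theorem branchTerm_eq_zero (b : CoeffMap) (f : E → E) (z : E) (s : OTree)
    (ν : Multiset RTree × SkeletonExponent) (h : vertexDegree ν < s.order) :
    s.branchTerm b f z ν = 0 := by
  refine sum_eq_zero fun q _ => if_neg fun h' => ?_
  rw [← h', vertexDegree_branchExponent] at h
  exact lt_irrefl _ h

end OTree

/-- The sum over all partitioned trees attached to a root by a dashed or a solid edge. -/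
noncomputable def branchSeries (b : CoeffMap) (f : E → E) (z : E)
    (ν : Multiset RTree × SkeletonExponent) : E :=
  ∑ s ∈ OTree.upTo (vertexDegree ν), s.branchTerm b f z ν

/-- The sum over all partitioned trees, with the skeleton marked by a formal variable. -/
noncomputable def skeletonSeries (b : CoeffMap) (f : E → E) (z : E) (l : SkeletonExponent) : E :=
  ∑ s ∈ OTree.upTo l.1, ∑ p : s.Partition, if (s.order, {s.skeleton p}) = l then
    ((s.branchFactorial : ℝ)⁻¹ * (b (some (s.rootClass p)) * s.otherCoeff b p)) • s.elemDiff f z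
    else 0

theorem branchSeries_zero_left (b : CoeffMap) (f : E → E) (z : E) (l : SkeletonExponent) :
    branchSeries b f z (0, l) = skeletonSeries b f z l := by
  simp only [branchSeries, skeletonSeries, AddMonoidHom.coprod_apply, map_zero, zero_add,
    AddMonoidHom.coe_fst]
  refine sum_congr rfl fun s _ => ?_
  simp [OTree.branchTerm, Fintype.sum_prod_type, OTree.branchExponent, OTree.branchCoeff]

theorem branchSeries_eq_zero (b : CoeffMap) (f : E → E) (z : E) {κ : Multiset RTree} (h0 : κ ≠ 0)
    (h : ∀ t, κ ≠ {t}) (l : SkeletonExponent) : branchSeries b f z (κ, l) = 0 := by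
  refine sum_eq_zero fun s _ => sum_eq_zero fun q _ => if_neg fun h' => ?_
  rcases q with ⟨_ | _, p⟩
  · exact h _ (congrArg Prod.fst h').symm
  · exact h0 (congrArg Prod.fst h').symm

theorem branchSeries_singleton (b : CoeffMap) (f : E → E) (z : E) (t : RTree)
    (l : SkeletonExponent) :
    branchSeries b f z ({t}, l) = ∑ s ∈ OTree.upTo (t.order + l.1), ∑ p : s.Partition,
      if s.rootClass p = t ∧ forestOrder (s.otherParts p) = l.1 ∧ s.skeletonForest p = l.2 then
        ((s.branchFactorial : ℝ)⁻¹ * s.otherCoeff b p) • s.elemDiff f z else 0 := by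
  simp only [branchSeries, AddMonoidHom.coprod_apply, AddMonoidHom.coe_fst, forestOrder_singleton]
  refine sum_congr rfl fun s _ => ?_
  simp [OTree.branchTerm, Fintype.sum_prod_type, OTree.branchExponent, OTree.branchCoeff,
    Prod.ext_iff]

/-- A partition of a tree is a choice, for each branch, of a dashed or solid edge and of a partition
of that branch. So grafting the branch series to a new root yields all partitioned trees, and the
root part is `t` exactly when the solid branches supply the branches of `t`. -/
theorem branchSeries_singleton_eq_formalTaylor (b : CoeffMap) (f : E → E) (z : E) (t : RTree)
    (l : SkeletonExponent) :
    branchSeries b f z ({t}, l)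
      = formalTaylor vertexDegree z (branchSeries b f z) f (t.branchClasses, l) := by
  have h := formalTaylor_tree_sum (d := vertexDegree) (OTree.branchTerm_eq_zero b f z) z f
    (t.branchClasses, l) (N := t.order + l.1)
    (by simp [t.order_eq_forestOrder])
  rw [branchSeries_singleton]
  refine Eq.trans ?_ h.symm
  refine sum_congr rfl fun s _ => ?_
  rcases s with ⟨m, c⟩
  refine Eq.trans ?_ (OTree.graftTerm_decorated (I := fun s => Bool × s.Partition)
    (fun s => s.branchExponent) (fun s => s.branchCoeff b) f z (t.branchClasses, l) c).symm
  refine Fintype.sum_equiv (Equiv.refl ((OTree.node m c).Partition)) _ _ fun p => ?_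
  simp only [Equiv.refl_apply]
  refine if_congr ?_ (by rw [OTree.prod_branchCoeff]) rfl
  rw [OTree.sum_branchExponent, OTree.rootClass, OTree.toRTree_eq_iff_eq_branchClasses, Prod.ext_iff, Prod.ext_iff,
    OTree.branchClasses_toRTree, eq_comm]

theorem skeletonSeries_of_fst_eq_zero (b : CoeffMap) (f : E → E) (z : E) (l : SkeletonExponent)
    (h : hDegree l = 0) : skeletonSeries b f z l = 0 := by
  refine sum_eq_zero fun s hs => ?_
  have := s.one_le_order
  rw [OTree.mem_upTo] at hs
  change l.1 = 0 at h
  omega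

/-- Only exponents `κ = 0` (dashed edge) and `κ = {t}` (solid edge) matter. In the second case both
sides obey the same grafting equation, whose right-hand side involves one vertex less. -/
theorem branchSeries_eq_composedDisplacement (b : CoeffMap) {f : E → E} (hf : ContDiff ℝ ∞ f)
    (z : E) (n : ℕ) : ∀ ν, vertexDegree ν ≤ n → branchSeries b f z ν
      = composedDisplacement hDegree z (skeletonSeries b f z) (markedField f) ν := by
  induction n using Nat.strong_induction_on with
  | _ n ih =>
  rintro ⟨κ, l⟩ hν
  by_cases h0 : κ = 0
  · subst h0
    have : formalTaylor hDegree z (skeletonSeries b f z) (0 : E → E) l = 0 := formalTaylor_zero z l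
    rw [branchSeries_zero_left, composedDisplacement, if_pos rfl, markedField_zero, this, add_zero]
  by_cases h1 : ∃ t, κ = {t}
  · obtain ⟨t, rfl⟩ := h1
    have hdeg : vertexDegree (t.branchClasses, l) < n := by
      simp only [AddMonoidHom.coprod_apply, forestOrder_singleton, t.order_eq_forestOrder] at hν ⊢
      omega
    -- After the induction hypothesis replaces the branch series inside `f`, the composition rule
    -- moves the shift `z + u` outside, where the grafting equation of the marked field applies.
    rw [branchSeries_singleton_eq_formalTaylor, formalTaylor_congr z f
      fun ν hν => ih _ hdeg ν hν, formalTaylor_composedDisplacement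
      eq_zero_of_forestOrder_eq_zero (skeletonSeries_of_fst_eq_zero b f z)
      (contDiff_markedField hf) (markedField_zero f) z _ hf _ le_rfl, composedDisplacement,
      if_neg h0, zero_add]
    simp only [formalTaylor_markedField]
  · push Not at h1
    have : formalTaylor hDegree z (skeletonSeries b f z) (0 : E → E) l = 0 := formalTaylor_zero z l
    rw [branchSeries_eq_zero b f z h0 h1, composedDisplacement, if_neg h0,
      markedField_eq_zero f h1, this, add_zero]

theorem branchSeries_singleton_eq (b : CoeffMap) {f : E → E} (hf : ContDiff ℝ ∞ f) (z : E)
    (t : RTree) (l : SkeletonExponent) : branchSeries b f z ({t}, l)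
      = formalTaylor hDegree z (skeletonSeries b f z) (markedField f {t}) l := by
  rw [branchSeries_eq_composedDisplacement b hf z _ _ le_rfl, composedDisplacement,
    if_neg (Multiset.singleton_ne_zero t), zero_add]

theorem markedField_singleton {f : E → E} (hf : ContDiff ℝ ∞ f) (t : RTree) (z : E) :
    markedField f {t} z = ((t.symmetry : ℝ)⁻¹) • t.elemDiff f z := by
  have h := RTree.sum_ofOrder t.order
    (fun s => if s.toRTree = t then s.elemDiff f z else 0) (fun s s' hs => by
      simp only [hs.toRTree_eq, hs.elemDiff_eq hf])
  simp only [RTree.toRTree_rep, smul_ite, smul_zero] at h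
  rw [sum_ite_eq' (RTree.ofOrder t.order) t fun r => ((r.symmetry : ℝ)⁻¹) • r.rep.elemDiff f z,
    if_pos (RTree.mem_ofOrder.2 rfl)] at h
  rw [markedField, RTree.elemDiff, h, forestOrder_singleton, sum_filter]
  refine sum_congr rfl fun s _ => ?_
  simp only [Multiset.singleton_inj]
  by_cases hs : s.toRTree = t
  · rw [if_pos hs, if_pos (by rw [← hs, OTree.order_toRTree])]
  · simp [hs]

/-- Sorts partitioned trees by the class `r` of the root part, which accounts for the missing factor
`b(r)` and for the missing power `h^|r|`; the mark of the skeleton is traded for the marks of its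
branches. -/
theorem skeletonSeries_eq_sum (b : CoeffMap) (f : E → E) (z : E) (n : ℕ) (t : RTree) :
    skeletonSeries b f z (n, {t}) = ∑ p ∈ antidiagonal n, ∑ r ∈ RTree.ofOrder p.1,
      b (some r) • branchSeries b f z ({r}, (p.2, t.branchClasses)) := by
  have h1 : ∀ p ∈ antidiagonal n, ∑ r ∈ RTree.ofOrder p.1,
      b (some r) • branchSeries b f z ({r}, (p.2, t.branchClasses))
      = ∑ s ∈ OTree.upTo n, ∑ q : s.Partition, ∑ r ∈ RTree.ofOrder p.1,
        if s.rootClass q = r then if forestOrder (s.otherParts q) = p.2 ∧ s.skeleton q = t then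
          ((s.branchFactorial : ℝ)⁻¹ * (b (some (s.rootClass q)) * s.otherCoeff b q)) •
            s.elemDiff f z else 0 else 0 := by
    intro p hp
    rw [mem_antidiagonal] at hp
    rw [sum_congr rfl fun s _ => sum_comm, sum_comm]
    refine sum_congr rfl fun r hr => ?_
    rw [RTree.mem_ofOrder] at hr
    rw [branchSeries_singleton, hr, hp, smul_sum]
    refine sum_congr rfl fun s _ => ?_
    rw [smul_sum]
    refine sum_congr rfl fun q _ => ?_
    have hiff : s.skeleton q = t ↔ s.skeletonForest q = t.branchClasses := by
      rw [OTree.skeleton_eq_iff, eq_comm]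
    simp only [hiff]
    by_cases h : s.rootClass q = r
    · rw [if_pos h]
      simp only [h, true_and, smul_ite, smul_zero, smul_smul]
      congr 2
      ring
    · simp [h]
  rw [sum_congr rfl h1, sum_comm, skeletonSeries]
  refine sum_congr rfl fun s _ => ?_
  rw [sum_comm]
  refine sum_congr rfl fun q _ => ?_
  simp only [sum_ite_eq, RTree.mem_ofOrder]
  have hord := s.order_rootClass_add q
  by_cases h : s.order = n ∧ s.skeleton q = t
  · obtain ⟨hn, ht⟩ := h
    rw [if_pos (by rw [hn, ht]), sum_eq_single ((s.rootClass q).order, forestOrder (s.otherParts q))]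
    · simp [ht]
    · rintro ⟨x, y⟩ _ hne
      split_ifs with hx hy
      · exact absurd (Prod.ext hx.symm hy.1.symm) hne
      · rfl
      · rfl
    · intro hn'
      rw [mem_antidiagonal] at hn'
      exact absurd (hord.trans hn) hn'
  · rw [if_neg fun h' => h ⟨congrArg Prod.fst h', by
      simpa using congrArg Prod.snd h'⟩, sum_eq_zero]
    rintro ⟨x, y⟩ hxy
    rw [mem_antidiagonal] at hxy
    split_ifs with hx hy
    · exfalso
      refine h ⟨?_, hy.2⟩
      rw [← hord, hx, hy.1, hxy]
    · rfl
    · rfl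

theorem bSeries_eq_sum_markedField {b : CoeffMap} (hb : b none = 0) {f : E → E}
    (hf : ContDiff ℝ ∞ f) (n : ℕ) (z : E) :
    bSeries f b n z = ∑ t ∈ RTree.ofOrder n, b (some t) • markedField f {t} z := by
  simp only [bSeries, hb, zero_smul, ite_self, zero_add, markedField_singleton hf, smul_smul,
    div_eq_mul_inv]

/-- The fixed point equation of the series of all partitioned trees. -/
theorem skeletonSeries_eq_formalTaylor {b : CoeffMap} (hb : b none = 0) {f : E → E}
    (hf : ContDiff ℝ ∞ f) (z : E) (n : ℕ) (t : RTree) :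
    skeletonSeries b f z (n, {t}) = ∑ p ∈ antidiagonal n,
      formalTaylor hDegree z (skeletonSeries b f z) (bSeries f b p.1) (p.2, t.branchClasses) := by
  rw [skeletonSeries_eq_sum]
  refine sum_congr rfl fun p _ => ?_
  rw [funext (bSeries_eq_sum_markedField hb hf p.1), formalTaylor_sum z _ fun r _ =>
    (contDiff_markedField hf {r}).const_smul (b (some r))]
  refine sum_congr rfl fun r _ => ?_
  rw [formalTaylor_const_smul z (contDiff_markedField hf {r}), branchSeries_singleton_eq b hf]

end Substitution

/-! ### The method's series and the substitution theorem. -/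

section MethodSeries

open Finset hiding antidiagonal mem_antidiagonal
open Finset.HasAntidiagonal (antidiagonal mem_antidiagonal)

variable {E : Type} [NormedAddCommGroup E] [NormedSpace ℝ E]

/-- The contribution of an ordered tree to the B-series of a formal vector field, with the tree
marked by a formal variable. -/
noncomputable def OTree.methodTerm (G : FormalSeries E) (z : E) (s : OTree)
    (l : SkeletonExponent) : E :=
  if {s.toRTree} = l.2 then ((s.branchFactorial : ℝ)⁻¹) • s.scaledElemDiff G l.1 z else 0

/-- The B-series of a formal vector field, with the trees marked by formal variables. -/
noncomputable def methodSeries (G : FormalSeries E) (z : E) (l : SkeletonExponent) : E :=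
  ∑ s ∈ OTree.upTo (hDegree l), s.methodTerm G z l

theorem OTree.methodTerm_eq_zero (G : FormalSeries E) (z : E) (s : OTree) (l : SkeletonExponent)
    (h : hDegree l < s.order) : s.methodTerm G z l = 0 := by
  rw [OTree.methodTerm, OTree.scaledElemDiff_of_lt G (show l.1 < s.order from h), smul_zero, ite_self]

/-- Each branch carries one fixed mark, so the marks in a nonzero term are forced and only the
powers of `h` remain to be distributed. -/
theorem OTree.sum_map_methodTerm (G : FormalSeries E) (z : E) {m : ℕ}
    (L : ContinuousMultilinearMap ℝ (fun _ : Fin m => E) E) (c : Fin m → OTree)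
    (l : SkeletonExponent) :
    ∑ κ ∈ finAntidiagonal m l, L (fun i => (c i).methodTerm G z (κ i))
      = if (OTree.node m c).branchClasses = l.2 then
          (∏ i, ((c i).branchFactorial : ℝ)⁻¹) •
            ∑ κ ∈ finAntidiagonal m l.1, L (fun i => (c i).scaledElemDiff G (κ i) z)
        else 0 := by
  have hz : ∀ κ : Fin m → SkeletonExponent, (∃ i, {(c i).toRTree} ≠ (κ i).2) →
      L (fun i => (c i).methodTerm G z (κ i)) = 0 := by
    rintro κ ⟨i, hi⟩
    exact L.map_coord_zero i (if_neg hi)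
  split_ifs with h
  · rw [smul_sum]
    symm
    refine sum_of_injOn (fun κ i => (κ i, {(c i).toRTree})) ?_ ?_ ?_ ?_
    · intro κ _ κ' _ h
      funext i
      exact congrArg Prod.fst (congrFun h i)
    · intro κ hκ
      rw [mem_coe, mem_finAntidiagonal] at hκ ⊢
      refine Prod.ext ?_ ?_
      · rw [Prod.fst_sum, hκ]
      · rw [Prod.snd_sum, ← h, OTree.branchClasses_node]
    · intro κ hκ hn
      refine hz κ ?_
      by_contra! h'
      refine hn ⟨fun i => (κ i).1, ?_, ?_⟩
      · rw [mem_finAntidiagonal] at hκ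
        rw [mem_coe, mem_finAntidiagonal, ← hκ, Prod.fst_sum]
      · funext i
        exact Prod.ext rfl (h' i)
    · intro κ _
      simp only [OTree.methodTerm, if_true]
      rw [ContinuousMultilinearMap.map_smul_univ]
  · refine sum_eq_zero fun κ hκ => hz κ ?_
    by_contra! h'
    rw [mem_finAntidiagonal] at hκ
    refine h ?_
    rw [OTree.branchClasses_node, ← hκ, Prod.snd_sum]
    exact sum_congr rfl fun i _ => h' i

/-- The fixed point equation of the B-series of a formal vector field. -/
theorem methodSeries_eq_formalTaylor (G : FormalSeries E) (z : E) (n : ℕ) (t : RTree) :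
    methodSeries G z (n, {t}) = ∑ p ∈ antidiagonal n,
      formalTaylor hDegree z (methodSeries G z) (G.hMul p.1) (p.2, t.branchClasses) := by
  have h1 : ∀ p ∈ antidiagonal n,
      formalTaylor hDegree z (methodSeries G z) (G.hMul p.1) (p.2, t.branchClasses)
      = ∑ s ∈ OTree.upTo (n + 1), s.graftTerm (OTree.methodTerm G z) z (G.hMul p.1)
          (p.2, t.branchClasses) := by
    intro p hp
    rw [mem_antidiagonal] at hp
    exact formalTaylor_tree_sum (d := hDegree) (fun s l => OTree.methodTerm_eq_zero G z s l) z _ _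
      (by simp only [AddMonoidHom.coe_fst]; omega)
  rw [sum_congr rfl h1, sum_comm]
  have h2 : methodSeries G z (n, {t}) = ∑ s ∈ OTree.upTo (n + 1), s.methodTerm G z (n, {t}) := by
    refine sum_subset (fun s hs => ?_) fun s _ hs => ?_
    · rw [OTree.mem_upTo] at hs ⊢
      exact hs.trans (Nat.le_succ n)
    · rw [OTree.mem_upTo] at hs
      exact OTree.methodTerm_eq_zero G z s _ (not_le.1 hs)
  rw [h2]
  refine sum_congr rfl fun s _ => ?_
  rcases s with ⟨m, c⟩
  simp only [OTree.graftTerm, OTree.sum_map_methodTerm]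
  simp only [OTree.methodTerm, Multiset.singleton_inj, OTree.toRTree_eq_iff_eq_branchClasses,
    eq_comm (a := t.branchClasses)]
  split_ifs with h
  · rw [OTree.scaledElemDiff_node, smul_sum]
    refine sum_congr rfl fun p _ => ?_
    rw [smul_smul]
    congr 1
    rw [OTree.branchFactorial]
    push_cast
    rw [mul_inv, prod_inv_distrib]
  · simp

theorem methodSeries_of_ne_singleton (G : FormalSeries E) (z : E) {l : SkeletonExponent}
    (h : ∀ t, l.2 ≠ {t}) : methodSeries G z l = 0 :=
  sum_eq_zero fun _ _ => if_neg (h _).symm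

theorem skeletonSeries_of_ne_singleton (b : CoeffMap) (f : E → E) (z : E) {l : SkeletonExponent}
    (h : ∀ t, l.2 ≠ {t}) : skeletonSeries b f z l = 0 :=
  sum_eq_zero fun _ _ => sum_eq_zero fun _ _ => if_neg fun h' =>
    h _ (congrArg Prod.snd h').symm

/-- The substitution theorem for B-series, for each skeleton separately. -/
theorem methodSeries_eq_skeletonSeries {b : CoeffMap} (hb : b none = 0) {f : E → E}
    (hf : ContDiff ℝ ∞ f) {g : FormalSeries E} (hg : g.hMul = bSeries f b) (z : E) (n : ℕ)
    (S : Multiset RTree) : methodSeries g z (n, S) = skeletonSeries b f z (n, S) := by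
  induction n using Nat.strong_induction_on generalizing S with
  | _ n ih =>
  by_cases hS : ∃ t, S = {t}
  · obtain ⟨t, rfl⟩ := hS
    rw [methodSeries_eq_formalTaylor, skeletonSeries_eq_formalTaylor hb hf, hg]
    refine sum_congr rfl fun p hp => ?_
    rw [mem_antidiagonal] at hp
    -- As `hg` has no constant term in `h`, only `p.1 ≥ 1` contributes, and then the right-hand side
    -- involves only powers of `h` below `n`.
    by_cases h0 : p.1 = 0
    · have : bSeries f b 0 = fun _ => (0 : E) := by
        rw [← hg]
        rfl
      rw [h0, this, formalTaylor_zero, formalTaylor_zero]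
    · refine formalTaylor_congr z _ fun ν hν => ih ν.1 ?_ ν.2
      simp only [AddMonoidHom.coe_fst] at hν
      omega
  · push Not at hS
    rw [methodSeries_of_ne_singleton g z hS, skeletonSeries_of_ne_singleton b f z hS]

end MethodSeries

/-! ### Taylor coefficients of a smooth function along a curve. -/

section Curves

open Finset hiding antidiagonal mem_antidiagonal
open Finset.HasAntidiagonal (antidiagonal mem_antidiagonal)

variable {E F : Type} [NormedAddCommGroup E] [NormedSpace ℝ E] [NormedAddCommGroup F]
  [NormedSpace ℝ F]

/-- The Taylor coefficients of a curve. -/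
noncomputable def taylorCoeff (t₀ : ℝ) (p : ℝ → E) (k : ℕ) : E :=
  ((k.factorial : ℝ)⁻¹) • iteratedDeriv k p t₀

theorem taylorCoeff_zero (t₀ : ℝ) (p : ℝ → E) : taylorCoeff t₀ p 0 = p t₀ := by
  simp [taylorCoeff]

theorem smul_taylorCoeff_succ (t₀ : ℝ) (p : ℝ → E) (k : ℕ) :
    ((k + 1 : ℕ) : ℝ) • taylorCoeff t₀ p (k + 1) = taylorCoeff t₀ (deriv p) k := by
  rw [taylorCoeff, taylorCoeff, iteratedDeriv_succ', smul_smul, Nat.factorial_succ]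
  congr 1
  push_cast
  field_simp

theorem Filter.EventuallyEq.taylorCoeff_eq {t₀ : ℝ} {p q : ℝ → E} (h : p =ᶠ[𝓝 t₀] q) (k : ℕ) :
    taylorCoeff t₀ p k = taylorCoeff t₀ q k := by
  rw [taylorCoeff, taylorCoeff, h.iteratedDeriv_eq]

theorem taylorCoeff_add {t₀ : ℝ} {p q : ℝ → E} (hp : ContDiffAt ℝ ∞ p t₀)
    (hq : ContDiffAt ℝ ∞ q t₀) (k : ℕ) :
    taylorCoeff t₀ (fun t => p t + q t) k = taylorCoeff t₀ p k + taylorCoeff t₀ q k := by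
  rw [taylorCoeff, iteratedDeriv_fun_add (hp.of_le (mod_cast le_top))
    (hq.of_le (mod_cast le_top)), smul_add]
  rfl

theorem ContDiffAt.contDiffAt_deriv {t₀ : ℝ} {p : ℝ → E} (hp : ContDiffAt ℝ ∞ p t₀) :
    ContDiffAt ℝ ∞ (deriv p) t₀ := by
  have h : deriv p = fun t => fderiv ℝ p t 1 := rfl
  rw [h]
  exact (hp.fderiv_right (m := ∞) le_rfl).clm_apply contDiffAt_const

theorem ContDiffAt.eventually_differentiableAt {t₀ : ℝ} {p : ℝ → E} (hp : ContDiffAt ℝ ∞ p t₀) :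
    ∀ᶠ t in 𝓝 t₀, DifferentiableAt ℝ p t :=
  ((hp.of_le (m := 1) (mod_cast le_top)).eventually (by simp)).mono fun _ h =>
    h.differentiableAt (by simp)

/-- The Leibniz rule for Taylor coefficients. -/
theorem taylorCoeff_clm_apply {t₀ : ℝ} (n : ℕ) : ∀ {p : ℝ → E →L[ℝ] F} {q : ℝ → E}
    (_ : ContDiffAt ℝ ∞ p t₀) (_ : ContDiffAt ℝ ∞ q t₀),
    taylorCoeff t₀ (fun t => p t (q t)) n
      = ∑ x ∈ antidiagonal n, taylorCoeff t₀ p x.1 (taylorCoeff t₀ q x.2) := by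
  induction n with
  | zero =>
    intro p q _ _
    rw [Nat.antidiagonal_zero, sum_singleton]
    simp only [taylorCoeff_zero]
  | succ n ih =>
    intro p q hp hq
    have hne : ((n + 1 : ℕ) : ℝ) ≠ 0 := by positivity
    refine smul_right_injective F hne ?_
    change ((n + 1 : ℕ) : ℝ) • _ = ((n + 1 : ℕ) : ℝ) • _
    have hd : deriv (fun t => p t (q t)) =ᶠ[𝓝 t₀] fun t => deriv p t (q t) + p t (deriv q t) := by
      filter_upwards [hp.eventually_differentiableAt, hq.eventually_differentiableAt] with t h1 h2
      exact (h1.hasDerivAt.clm_apply h2.hasDerivAt).deriv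
    rw [smul_taylorCoeff_succ, hd.taylorCoeff_eq,
      taylorCoeff_add (hp.contDiffAt_deriv.clm_apply hq) (hp.clm_apply hq.contDiffAt_deriv),
      ih hp.contDiffAt_deriv hq, ih hp hq.contDiffAt_deriv]
    simp only [← smul_taylorCoeff_succ, map_smul, smul_apply]
    have h1 := Nat.sum_antidiagonal_succ (n := n) (f := fun x : ℕ × ℕ =>
      (x.1 : ℝ) • taylorCoeff t₀ p x.1 (taylorCoeff t₀ q x.2))
    have h2 := Nat.sum_antidiagonal_succ' (n := n) (f := fun x : ℕ × ℕ =>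
      (x.2 : ℝ) • taylorCoeff t₀ p x.1 (taylorCoeff t₀ q x.2))
    simp only [Nat.cast_zero, zero_smul, zero_add] at h1 h2
    rw [← h1, ← h2, ← sum_add_distrib, smul_sum]
    refine sum_congr rfl fun x hx => ?_
    rw [mem_antidiagonal] at hx
    rw [← add_smul, ← hx]
    push_cast
    rfl

/-- The Taylor coefficients of a curve without the constant term. -/
noncomputable def curveDisplacement (t₀ : ℝ) (p : ℝ → E) (k : ℕ) : E :=
  if k = 0 then 0 else taylorCoeff t₀ p k

/-- The Taylor coefficients of a smooth function along a smooth curve. -/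
theorem taylorCoeff_comp {t₀ : ℝ} {p : ℝ → E} (hp : ContDiffAt ℝ ∞ p t₀) (n : ℕ) :
    ∀ {F : Type} [NormedAddCommGroup F] [NormedSpace ℝ F] {φ : E → F} (_ : ContDiff ℝ ∞ φ),
      taylorCoeff t₀ (fun t => φ (p t)) n
        = formalTaylor (AddMonoidHom.id ℕ) (p t₀) (curveDisplacement t₀ p) φ n := by
  induction n using Nat.strong_induction_on with
  | _ n ih =>
  intro F _ _ φ hφ
  cases n with
  | zero =>
    rw [taylorCoeff_zero, formalTaylor_of_degree_eq_zero _ _ (by simp), if_pos rfl]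
  | succ n =>
    have hne : ((n + 1 : ℕ) : ℝ) ≠ 0 := by positivity
    refine smul_right_injective F hne ?_
    change ((n + 1 : ℕ) : ℝ) • _ = ((n + 1 : ℕ) : ℝ) • _
    have hφ' : ContDiff ℝ ∞ (fderiv ℝ φ) := hφ.fderiv_right le_rfl
    have hd : deriv (fun t => φ (p t)) =ᶠ[𝓝 t₀] fun t => fderiv ℝ φ (p t) (deriv p t) := by
      filter_upwards [hp.eventually_differentiableAt] with t h1
      exact (((hφ.differentiable (by simp)) (p t)).hasFDerivAt.comp_hasDerivAt t
        h1.hasDerivAt).deriv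
    have hcomp : ContDiffAt ℝ ∞ (fun t => fderiv ℝ φ (p t)) t₀ :=
      hφ'.contDiffAt.comp t₀ hp
    -- With the degree itself as derivation, the formal chain rule mirrors differentiation of `φ (p
    -- t)`.
    have hR := smul_formalTaylor (d := AddMonoidHom.id ℕ) (u := curveDisplacement t₀ p)
      (fun μ hμ => if_pos hμ) hφ (p t₀) (AddMonoidHom.id ℕ) (n + 1)
    simp only [AddMonoidHom.id_apply] at hR
    rw [hR, Nat.sum_antidiagonal_succ', smul_taylorCoeff_succ, hd.taylorCoeff_eq,
      taylorCoeff_clm_apply n hcomp hp.contDiffAt_deriv]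
    simp only [Nat.cast_zero, zero_smul, zero_add]
    refine sum_congr rfl fun x hx => ?_
    rw [mem_antidiagonal] at hx
    rw [ih x.1 (by omega) hφ', ← smul_taylorCoeff_succ, map_smul, curveDisplacement,
      if_neg (Nat.succ_ne_zero _)]

end Curves

/-! ### The B-series of the exact flow. -/

section ExactFlow

open Finset hiding antidiagonal mem_antidiagonal
open Finset.HasAntidiagonal (antidiagonal mem_antidiagonal)

variable {E : Type} [NormedAddCommGroup E] [NormedSpace ℝ E]

/-- Bootstrapping: if `z` is `C^n` on an open set, its derivative `f ∘ z` is `C^n` there, so `z` is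
`C^(n+1)`. -/
theorem IsLocalSolution.contDiffAt {f : E → E} (hf : ContDiff ℝ ∞ f) {t₀ : ℝ} {z₀ : E}
    {z : ℝ → E} (hz : IsLocalSolution f t₀ z₀ z) : ContDiffAt ℝ ∞ z t₀ := by
  obtain ⟨s, hs, hso, hts⟩ := eventually_nhds_iff.1 hz.2
  have hd : DifferentiableOn ℝ z s := fun t ht => (hs t ht).differentiableAt.differentiableWithinAt
  have h : ∀ n : ℕ, ContDiffOn ℝ n z s := by
    intro n
    induction n with
    | zero => exact contDiffOn_zero.2 hd.continuousOn
    | succ n ih =>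
      rw [Nat.cast_add, Nat.cast_one, contDiffOn_succ_iff_deriv_of_isOpen hso]
      refine ⟨hd, by simp, ?_⟩
      exact ((hf.of_le (mod_cast le_top)).comp_contDiffOn ih).congr fun t ht => (hs t ht).deriv
  exact contDiffAt_infty.2 fun n => (h n).contDiffAt (hso.mem_nhds hts)

/-- The B-series of the exact flow, as a sum over ordered trees and without the constant term. -/
noncomputable def flowSeries (f : E → E) (z : E) (k : ℕ) : E :=
  ∑ s ∈ OTree.upTo k, if s.order = k then
    ((s.branchFactorial : ℝ)⁻¹ * (s.density : ℝ)⁻¹) • s.elemDiff f z else 0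

theorem flowSeries_zero (f : E → E) (z : E) : flowSeries f z 0 = 0 :=
  sum_eq_zero fun s _ => if_neg (by have := s.one_le_order; omega)

/-- The coefficientwise form of `ż = f(z)`: grafting multiplies the `1/γ` of the branches, and the
factor `k + 1` cancels the order of the new tree in its density. -/
theorem formalTaylor_flowSeries (f : E → E) (z : E) (k : ℕ) :
    formalTaylor (AddMonoidHom.id ℕ) z (flowSeries f z) f k
      = ((k + 1 : ℕ) : ℝ) • flowSeries f z (k + 1) := by
  have hw : ∀ (s : OTree) (κ : ℕ), AddMonoidHom.id ℕ κ < s.order →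
      (∑ _q : Unit, if s.order = κ then
        ((s.branchFactorial : ℝ)⁻¹ * (s.density : ℝ)⁻¹) • s.elemDiff f z else 0) = 0 := by
    intro s κ h
    refine sum_eq_zero fun _ _ => if_neg ?_
    simp only [AddMonoidHom.id_apply] at h
    omega
  have h := formalTaylor_tree_sum hw z f k le_rfl
  simp only [univ_unique, sum_singleton] at h
  refine h.trans ?_
  rw [flowSeries, smul_sum]
  refine sum_congr rfl fun s _ => ?_
  rcases s with ⟨m, c⟩
  have hg := OTree.graftTerm_decorated (I := fun _ => Unit) (fun s _ => s.order)
    (fun s _ => (s.density : ℝ)⁻¹) f z k c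
  simp only [univ_unique, sum_singleton] at hg
  rw [hg, smul_ite, smul_zero]
  have hiff : ∑ i, (c i).order = k ↔ (OTree.node m c).order = k + 1 := by
    rw [OTree.order]
    omega
  refine if_ctx_congr hiff (fun hk => ?_) fun _ => rfl
  rw [smul_smul]
  congr 1
  have hden : (OTree.node m c).density = (k + 1) * ∏ i, (c i).density := by
    rw [← hk]
    rfl
  rw [hden]
  push_cast
  rw [mul_inv, prod_inv_distrib]
  have : ((k : ℝ) + 1) ≠ 0 := by positivity
  field_simp

/-- The Taylor coefficients of a solution are the coefficients of the B-series of the exact flow. -/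
theorem IsLocalSolution.taylorCoeff_eq {f : E → E} (hf : ContDiff ℝ ∞ f) {t₀ : ℝ} {z₀ : E}
    {z : ℝ → E} (hz : IsLocalSolution f t₀ z₀ z) (k : ℕ) :
    curveDisplacement t₀ z k = flowSeries f z₀ k := by
  induction k using Nat.strong_induction_on with
  | _ k ih =>
  cases k with
  | zero => rw [flowSeries_zero, curveDisplacement, if_pos rfl]
  | succ k =>
    have hne : ((k + 1 : ℕ) : ℝ) ≠ 0 := by positivity
    refine smul_right_injective E hne ?_
    change ((k + 1 : ℕ) : ℝ) • _ = ((k + 1 : ℕ) : ℝ) • _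
    have hd : deriv z =ᶠ[𝓝 t₀] fun t => f (z t) := hz.2.mono fun t h => h.deriv
    rw [curveDisplacement, if_neg (Nat.succ_ne_zero k), smul_taylorCoeff_succ, hd.taylorCoeff_eq,
      taylorCoeff_comp (hz.contDiffAt hf) k hf, hz.1, ← formalTaylor_flowSeries]
    exact formalTaylor_congr z₀ f fun ν hν => ih ν (Nat.lt_succ_of_le hν)

end ExactFlow

/-! ### Removing the marks and conclusion. -/

section Main

open Finset hiding antidiagonal mem_antidiagonal
open Finset.HasAntidiagonal (antidiagonal mem_antidiagonal)

variable {E : Type} [NormedAddCommGroup E] [NormedSpace ℝ E]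

theorem formalBSeries_eq_sum_scaledElemDiff {G : FormalSeries E} (hG : ∀ k, ContDiff ℝ ∞ (G k))
    (a : CoeffMap) (n : ℕ) (z : E) :
    formalBSeries G a n z = (if n = 0 then a none • z else 0)
      + ∑ s ∈ OTree.upTo n, ((s.branchFactorial : ℝ)⁻¹ * a (some s.toRTree)) •
          s.scaledElemDiff G n z := by
  rw [formalBSeries]
  congr 1
  have h1 : ∀ q ∈ antidiagonal n, ∑ t ∈ RTree.ofOrder q.1,
      (a (some t) / t.symmetry) • t.formalElemDiff G q.2 z
      = ∑ s ∈ OTree.upTo n, if s.order = q.1 then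
        ((s.branchFactorial : ℝ)⁻¹ * a (some s.toRTree)) • s.formalElemDiff G q.2 z else 0 := by
    intro q hq
    rw [mem_antidiagonal] at hq
    have h := RTree.sum_ofOrder q.1
      (fun s => a (some s.toRTree) • s.formalElemDiff G q.2 z) (fun s s' hs => by
        simp only [hs.toRTree_eq, hs.formalElemDiff_eq hG])
    simp only [RTree.toRTree_rep, smul_smul] at h
    simp only [RTree.formalElemDiff, div_eq_inv_mul]
    rw [h, ← sum_filter]
    refine sum_congr ?_ fun _ _ => rfl
    ext s
    simp only [mem_filter, OTree.mem_upTo]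
    omega
  rw [sum_congr rfl h1, sum_comm]
  refine sum_congr rfl fun s hs => ?_
  rw [OTree.mem_upTo] at hs
  rw [OTree.scaledElemDiff, if_pos hs, sum_eq_single (s.order, n - s.order)]
  · simp
  · rintro ⟨x, y⟩ hxy hne
    rw [mem_antidiagonal] at hxy
    refine if_neg fun h => hne ?_
    simp only at h hxy
    exact Prod.ext h.symm (by simp only; omega)
  · intro h
    rw [mem_antidiagonal] at h
    simp only at h
    omega

theorem contDiff_of_hMul_eq_bSeries {f : E → E} (hf : ContDiff ℝ ∞ f) {b : CoeffMap}
    (hb : b none = 0) {g : FormalSeries E} (hg : g.hMul = bSeries f b) (k : ℕ) :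
    ContDiff ℝ ∞ (g k) := by
  have h : g k = fun z => bSeries f b (k + 1) z := by
    rw [← hg]
    rfl
  rw [h]
  simp only [bSeries_eq_sum_markedField hb hf]
  exact ContDiff.sum fun t _ => (contDiff_markedField hf {t}).const_smul _

/-- The B-series of the modified field is the B-series with the substituted coefficients. -/
theorem sum_scaledElemDiff_eq_sum_substitution {b : CoeffMap} (hb : b none = 0) (a : CoeffMap)
    {f : E → E} (hf : ContDiff ℝ ∞ f) {g : FormalSeries E} (hg : g.hMul = bSeries f b) (n : ℕ)
    (z : E) :
    ∑ s ∈ OTree.upTo n, ((s.branchFactorial : ℝ)⁻¹ * a (some s.toRTree)) •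
        s.scaledElemDiff g n z
      = ∑ s ∈ OTree.upTo n, if s.order = n then
        ((s.branchFactorial : ℝ)⁻¹ * s.substitution b a) • s.elemDiff f z else 0 := by
  -- `T` contains every mark occurring on either side. Setting `x_t = a(t)`, that is, summing the
  -- identities for each skeleton over `T` with weights `a(t)`, removes the marks.
  set T : Finset RTree := (OTree.upTo n).image OTree.toRTree ∪
    (OTree.upTo n).biUnion fun s => univ.image s.skeleton with hT
  have h := sum_congr (rfl : T = T) fun t _ => congrArg (a (some t) • ·)
    (methodSeries_eq_skeletonSeries hb hf hg z n {t})
  simp only [methodSeries, skeletonSeries, OTree.methodTerm, smul_sum, AddMonoidHom.coe_fst] at h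
  rw [sum_comm, sum_comm (s := T)] at h
  refine Eq.trans ?_ (h.trans ?_)
  · refine sum_congr rfl fun s hs => ?_
    simp only [Multiset.singleton_inj, smul_ite, smul_zero, smul_smul]
    rw [sum_ite_eq, if_pos (mem_union_left _ (mem_image_of_mem _ hs)), mul_comm]
  · refine sum_congr rfl fun s hs => ?_
    rw [sum_comm]
    simp only [Prod.mk.injEq, Multiset.singleton_inj, ite_and, smul_ite, smul_zero, smul_smul]
    split_ifs
    · rw [OTree.substitution, mul_sum, sum_smul]
      refine sum_congr rfl fun p _ => ?_
      rw [sum_ite_eq, if_pos (mem_union_right _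
        (mem_biUnion.2 ⟨s, hs, mem_image_of_mem _ (mem_univ p)⟩))]
      congr 1
      ring
    · simp

end Main

/-- A smooth autonomous system has a solution near the initial time. -/
theorem exists_isLocalSolution {E : Type} [NormedAddCommGroup E] [NormedSpace ℝ E]
    [CompleteSpace E] {f : E → E} (hf : ContDiff ℝ ∞ f) (t₀ : ℝ) (z₀ : E) :
    ∃ z : ℝ → E, IsLocalSolution f t₀ z₀ z := by
  have h1 : ContDiffAt ℝ 1 f z₀ := hf.contDiffAt.of_le (by norm_cast)
  obtain ⟨r, hr, ε, hε, h⟩ :=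
    h1.exists_forall_mem_closedBall_exists_eq_forall_mem_Ioo_hasDerivAt t₀
  obtain ⟨z, hz, hd⟩ := h z₀ (Metric.mem_closedBall_self hr.le)
  exact ⟨z, hz, Filter.eventually_of_mem (Ioo_mem_nhds (by linarith) (by linarith)) hd⟩

/-- The method applied to the modified field has the B-series of the exact flow. -/
theorem formalBSeries_eq_flowSeries {E : Type} [NormedAddCommGroup E] [NormedSpace ℝ E]
    {a b : CoeffMap} (ha : a none = 1) (hb : b none = 0)
    (hba : ∀ τ : RTree, substitution b a (some τ) = 1 / (τ.density : ℝ))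
    {f : E → E} (hf : ContDiff ℝ ∞ f) {g : FormalSeries E} (hg : g.hMul = bSeries f b)
    (k : ℕ) (z : E) :
    formalBSeries g a k z = (if k = 0 then z else 0) + flowSeries f z k := by
  rw [formalBSeries_eq_sum_scaledElemDiff (contDiff_of_hMul_eq_bSeries hf hb hg), ha, one_smul,
    sum_scaledElemDiff_eq_sum_substitution hb a hf hg, flowSeries]
  simp only [← OTree.substitution_toRTree, hba, OTree.density_toRTree, one_div]

theorem theorem4p2 {n : ℕ}
    (Φ : FormalSeries (EuclideanSpace ℝ (Fin n)) → FormalSeries (EuclideanSpace ℝ (Fin n)))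
    (a b : CoeffMap) (hΦ : HasBSeries Φ a) (ha : a none = 1) (hb : b none = 0)
    (hba : ∀ τ : RTree, substitution b a (some τ) = 1 / (τ.density : ℝ))
    (f : EuclideanSpace ℝ (Fin n) → EuclideanSpace ℝ (Fin n)) (hf : ContDiff ℝ ∞ f)
    (g : FormalSeries (EuclideanSpace ℝ (Fin n))) (hg : g.hMul = bSeries f b)
    (t₀ : ℝ) (z₀ : EuclideanSpace ℝ (Fin n)) :
    (∃ z : ℝ → EuclideanSpace ℝ (Fin n), IsLocalSolution f t₀ z₀ z) ∧
      ∀ z : ℝ → EuclideanSpace ℝ (Fin n), IsLocalSolution f t₀ z₀ z →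
        ContDiffAt ℝ ∞ z t₀ ∧
          ∀ k : ℕ, Φ g k z₀ = ((k.factorial : ℝ)⁻¹) • iteratedDeriv k z t₀ := by
  refine ⟨exists_isLocalSolution hf t₀ z₀, fun z hz => ⟨hz.contDiffAt hf, fun k => ?_⟩⟩
  rw [hΦ g (contDiff_of_hMul_eq_bSeries hf hb hg),
    formalBSeries_eq_flowSeries ha hb hba hf hg, ← hz.taylorCoeff_eq hf, curveDisplacement]
  -- The displacement omits the constant term, which comes from `a(∅) z₀ = z₀` instead.
  split_ifs with hk
  · simp [hk, hz.1]
  · rw [zero_add, taylorCoeff]
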